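/- Let $K\ge 7$ and let $\varphi:\{1,\dots,K\}\to\mathbb R$ be a known injective map. Consider the following Bayesian bandit with $K$ arms (a chain of two magic actions). The index $m$ of the second magic arm is uniform on $\{2,\dots,K\}$, and independently the means $\mu_a$ are i.i.d. uniform on $[0,1]$. The arms $a\notin\{1,m\}$ are called regular, and $A^\star=\arg\max_{a\notin\{1,m\}}\mu_a$ is the best (regular) arm. Pulling arm $1$ yields $\varphi(m)$, pulling arm $m$ yields $\varphi(A^\star)$, and each pull of a regular arm $a$ yields an independent $\mathcal N(\mu_a,1)$ reward. Let $\mathcal D_t$ be the arms and rewards of the first $t$ pulls. A strategy consists of a (possibly randomized) sampling policy, a stopping time $\tau$ adapted to $(\sigma(\mathcal D_t))_t$, counting the pulls, and an inference rule $I$; it is $\delta$-correct if $\mathbb P(\tau<\infty,\ I_\tau(\mathcal D_\tau)=A^\star)\ge 1-\delta$, and sample-optimal if it is $\delta$-correct and minimizes $\mathbb E[\tau]$ among all $\delta$-correct strategies. Here probabilities and expectations include the draw of $(m,\mu)$. A sampling policy is myopic pure-exploration IDS if almost surely at every round it pulls an arm maximizing the information gain $$g_t(a)=H\big(\mathbb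 P(A^\star=\cdot\mid\mathcal D_t)\big)-\mathbb E\big[H\big(\mathbb P(A^\star=\cdot\mid\mathcal D_t,a,Y)\big)\,\big|\,\mathcal D_t\big],$$ where $H$ is the Shannon entropy and $Y$ is the reward of a pull of $a$ at the next round; ties are broken arbitrarily, possibly at random. Then there is $\delta_0\in(0,1/2)$, depending only on $K$, such that for every such $\varphi$ and every $\delta\in(0,\delta_0]$: 1. no strategy whose sampling policy is myopic pure-exploration IDS is sample-optimal; 2. every $\delta$-correct strategy whose sampling policy is myopic pure-exploration IDS has $\mathbb E[\tau]>2$; 3. there is a $\delta$-correct strategy with $\tau=2$ always. -/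

import Mathlib

open MeasureTheory ProbabilityTheory

namespace MagicChain

noncomputable section

/-- A problem instance `θ = (m, μ)` with `K` arms indexed by `Fin K`. The arm `0` is the first
magic arm (its index is known to the learner), `m` is the second magic arm, and `μ a` is the mean
of the arm `a` whenever `a` is regular, i.e. `a ≠ 0` and `a ≠ m`. -/
abbrev Instance (K : ℕ) : Type := Fin K × (Fin K → ℝ)

/-- The prior on instances: `m` is uniform over the arms other than `0`, and the means are
independent of `m` and i.i.d. uniform on `[0, 1]`. -/
def prior (K : ℕ) [NeZero K] : Measure (Instance K) :=
  (uniformOn {m : Fin K | m ≠ 0}).prod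
    (Measure.pi fun _ : Fin K => (volume : Measure ℝ).restrict (Set.Icc 0 1))

/-- `a` is regular and has the largest mean among the regular arms. -/
def IsBestRegular {K : ℕ} [NeZero K] (θ : Instance K) (a : Fin K) : Prop :=
  (a ≠ 0 ∧ a ≠ θ.1) ∧ ∀ b : Fin K, b ≠ 0 → b ≠ θ.1 → θ.2 b ≤ θ.2 a

open Classical in
/-- The best arm `A⋆ = argmax_{a ≠ 0, m} μ a`. It is almost surely unique under the prior; ties are
broken in favour of the smallest index. -/
def bestArm {K : ℕ} [NeZero K] (θ : Instance K) : Fin K :=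
  (Finset.univ.filter fun a => IsBestRegular θ a).min.untopD 0

/-- The reward of the arm `a` in the instance `θ` when the standard Gaussian noise is `ξ`. The first
magic arm yields `φ m`, the second magic arm `m` yields `φ A⋆`, and a regular arm yields `μ a + ξ`,
which is distributed as `N(μ a, 1)`. -/
def reward {K : ℕ} [NeZero K] (φ : Fin K → ℝ) (θ : Instance K) (a : Fin K) (ξ : ℝ) : ℝ :=
  if a = 0 then φ θ.1 else if a = θ.1 then φ (bestArm θ) else θ.2 a + ξ

/-- The first `n` pairs (arm, observed reward). -/
abbrev History (K n : ℕ) : Type := Fin n → Fin K × ℝ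

/-- A (possibly randomized) sampling policy: after the history `h` of length `n` the next arm is
`act n h u`, where `u` is a fresh uniform seed in `[0, 1]`. -/
structure Policy (K : ℕ) where
  act : ∀ n : ℕ, History K n → unitInterval → Fin K
  measurable_act : ∀ n, Measurable (Function.uncurry (act n))

/-- A fixed-confidence strategy: a sampling policy, a stopping rule (stop as soon as the current
history lies in `stopSet n`) and an inference rule. -/
structure Strategy (K : ℕ) extends Policy K where
  stopSet : ∀ n : ℕ, Set (History K n)
  measurableSet_stopSet : ∀ n, MeasurableSet (stopSet n)
  guess : ∀ n : ℕ, History K n → Fin K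
  measurable_guess : ∀ n, Measurable (guess n)

/-- The sample space: the instance, the reward noises and the seeds of the policy. -/
abbrev Outcome (K : ℕ) : Type := Instance K × (ℕ → ℝ) × (ℕ → unitInterval)

/-- The instance is drawn from the prior, the noises are i.i.d. `N(0, 1)`, the seeds are i.i.d.
uniform on `[0, 1]`, and the three are independent. -/
def law (K : ℕ) [NeZero K] : Measure (Outcome K) :=
  (prior K).prod
    ((Measure.infinitePi fun _ : ℕ => gaussianReal 0 1).prod
      (Measure.infinitePi fun _ : ℕ => (volume : Measure unitInterval)))

/-- The history after `n` queries when the policy `π` is run. -/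
def history {K : ℕ} [NeZero K] (φ : Fin K → ℝ) (π : Policy K) : ∀ n : ℕ, Outcome K → History K n
  | 0, _ => Fin.elim0
  | n + 1, ω =>
    let a := π.act n (history φ π n ω) (ω.2.2 n)
    Fin.snoc (α := fun _ => Fin K × ℝ) (history φ π n ω) (a, reward φ ω.1 a (ω.2.1 n))

/-- The arm that the policy `π` queries after `n` queries have been made. -/
def action {K : ℕ} [NeZero K] (φ : Fin K → ℝ) (π : Policy K) (n : ℕ) (ω : Outcome K) : Fin K :=
  π.act n (history φ π n ω) (ω.2.2 n)

/-- Shannon entropy (natural logarithm) of a distribution on the arms. -/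
def entropy {K : ℕ} (p : Measure (Fin K)) : ℝ := ∑ a, Real.negMulLog (p.real {a})

/-- The information gain of the arm `a` when the current belief about the instance is `ν`: the
entropy of the best arm under `ν`, minus the expectation of the entropy of the conditional law of
the best arm given the next reward `Y` when the arm `a` is queried. -/
def infoGain {K : ℕ} [NeZero K] (φ : Fin K → ℝ) (ν : Measure (Instance K)) [IsFiniteMeasure ν]
    (a : Fin K) : ℝ :=
  let J : Measure (Instance K × ℝ) := ν.prod (gaussianReal 0 1)
  let Y : Instance K × ℝ → ℝ := fun z => reward φ z.1 a z.2
  entropy (ν.map bestArm) - ∫ z, entropy (condDistrib (fun z => bestArm z.1) Y J (Y z)) ∂J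

instance (K : ℕ) [NeZero K] : IsFiniteMeasure (prior K) := by
  unfold prior uniformOn; infer_instance

instance (K : ℕ) [NeZero K] : IsFiniteMeasure (law K) := by
  unfold law; infer_instance

/-- The posterior law of the instance given the first `n` queries and rewards. -/
def posterior {K : ℕ} [NeZero K] (φ : Fin K → ℝ) (π : Policy K) (n : ℕ) :
    Kernel (History K n) (Instance K) :=
  condDistrib (fun ω : Outcome K => ω.1) (history φ π n) (law K)

instance {K : ℕ} [NeZero K] (φ : Fin K → ℝ) (π : Policy K) (n : ℕ) :
    IsMarkovKernel (posterior φ π n) := by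
  unfold posterior; infer_instance

/-- Myopic pure-exploration information-directed sampling: at every round the queried arm maximizes
the information gain under the current posterior, with arbitrary (possibly randomized and
history-dependent) tie-breaking. -/
def IsMyopicIDS {K : ℕ} [NeZero K] (φ : Fin K → ℝ) (π : Policy K) : Prop :=
  ∀ n : ℕ, ∀ᵐ ω ∂(law K), ∀ b : Fin K,
    infoGain φ (posterior φ π n (history φ π n ω)) b ≤
      infoGain φ (posterior φ π n (history φ π n ω)) (action φ π n ω)

/-- The number of queries made before stopping (`⊤` if the strategy never stops). -/
def stoppingTime {K : ℕ} [NeZero K] (φ : Fin K → ℝ) (s : Strategy K) (ω : Outcome K) : ℕ∞ :=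
  ⨅ (n : ℕ) (_ : history φ s.toPolicy n ω ∈ s.stopSet n), (n : ℕ∞)

/-- The expected number of queries. -/
def expectedStoppingTime {K : ℕ} [NeZero K] (φ : Fin K → ℝ) (s : Strategy K) : ENNReal :=
  ∫⁻ ω, (stoppingTime φ s ω : ENNReal) ∂(law K)

/-- With probability at least `1 - δ` the strategy stops and then names the best arm. -/
def IsDeltaCorrect {K : ℕ} [NeZero K] (φ : Fin K → ℝ) (δ : ℝ) (s : Strategy K) : Prop :=
  1 - δ ≤ (law K).real {ω | ∃ n : ℕ, stoppingTime φ s ω = n ∧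
    s.guess n (history φ s.toPolicy n ω) = bestArm ω.1}

/-- The strategy is `δ`-correct and has the least expected number of queries among all
`δ`-correct strategies. -/
def IsSampleOptimal {K : ℕ} [NeZero K] (φ : Fin K → ℝ) (δ : ℝ) (s : Strategy K) : Prop :=
  IsDeltaCorrect φ δ s ∧
    ∀ s' : Strategy K, IsDeltaCorrect φ δ s' →
      expectedStoppingTime φ s ≤ expectedStoppingTime φ s'

end

end MagicChain

namespace MagicChain

variable {K : ℕ}

/-! ### Exchanging two arms of an instance -/

/-! Pulling the two magic arms in succession decodes `m` and then the best arm, so two pulls suffice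
(`chainStrategy`). A one-step lookahead misses this. The first magic arm only excludes one
candidate, a gain of `log ((K-1)/(K-2)) ≤ 1/(K-2)` (`infoGain_zero`). Any other arm is magic with
probability `1/(K-1)` and then reveals the best arm outright, a gain of at least `log (K-1)/(K-1)`
(`le_infoGain`). For `K ≥ 7` the latter is strictly larger, so a myopic policy almost surely does
not open with arm `0` (`infoGain_zero_lt`, `IsMyopicIDS.ae_action_zero_ne_zero`).

What such a policy loses is computed by symmetry. Exchanging two nonzero arms preserves the law, and
it preserves the history as long as no reward seen so far depends on the exchange. Hence the first
two pulls miss both `m` and the best arm with probability at least `2/3` after one pull and `2/5`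
after two (`uninformed_succ_ge`). While they are missed, the best arm is exchangeable with some
unqueried arm, so stopping then is wrong at least half of the time, and `δ`-correctness makes it
rare (`IsDeltaCorrect.uninformed_stop_le`). Therefore `E[τ] ≥ P(τ ≥ 1) + P(τ ≥ 2) + P(τ ≥ 3) ≥ 1 +
2/3 + 2/5 - O(K²δ)`, which exceeds `2` for small `δ`. -/

/-- The instance in which the arms `i` and `c` exchange their roles. -/
def swapArms (i c : Fin K) : Instance K ≃ᵐ Instance K :=
  MeasurableEquiv.prodCongr
    ⟨Equiv.swap i c, measurable_of_finite _, measurable_of_finite _⟩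
    (MeasurableEquiv.piCongrLeft (fun _ => ℝ) (Equiv.swap i c))

lemma swapArms_fst (i c : Fin K) (θ : Instance K) :
    (swapArms i c θ).1 = Equiv.swap i c θ.1 := rfl

lemma swapArms_snd (i c : Fin K) (θ : Instance K) (a : Fin K) :
    (swapArms i c θ).2 a = θ.2 (Equiv.swap i c a) := by
  have h := Equiv.piCongrLeft_apply_apply (P := fun _ : Fin K => ℝ) (Equiv.swap i c) θ.2
    (Equiv.swap i c a)
  rw [Equiv.swap_apply_self] at h
  exact h

variable [NeZero K]

/-! ### The best regular arm -/

lemma exists_isBestRegular (hK : 3 ≤ K) (θ : Instance K) : ∃ a, IsBestRegular θ a := by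
  classical
  have hne : (Finset.univ.filter fun a : Fin K => a ≠ 0 ∧ a ≠ θ.1).Nonempty := by
    have hcard : ({0, θ.1} : Finset (Fin K)).card < Fintype.card (Fin K) := by
      have := Finset.card_le_two (a := (0 : Fin K)) (b := θ.1)
      simp only [Fintype.card_fin]; omega
    obtain ⟨a, ha⟩ := Finset.exists_mem_notMem_of_card_lt_card (s := {0, θ.1})
      (t := Finset.univ) (by simpa using hcard)
    exact ⟨a, by simpa using ha⟩
  obtain ⟨a, ha, hmax⟩ := Finset.exists_max_image _ θ.2 hne
  refine ⟨a, by simpa using ha, fun b hb hb' => hmax b (by simp [hb, hb'])⟩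

lemma isBestRegular_bestArm (hK : 3 ≤ K) (θ : Instance K) : IsBestRegular θ (bestArm θ) := by
  classical
  have hne : (Finset.univ.filter fun a => IsBestRegular θ a).Nonempty := by
    obtain ⟨a, ha⟩ := exists_isBestRegular hK θ
    exact ⟨a, by simpa using ha⟩
  obtain ⟨a, ha⟩ := Finset.min_of_nonempty hne
  have hb : bestArm θ = a := by
    unfold bestArm
    convert WithTop.untopD_coe (0 : Fin K) a
  have := Finset.mem_of_min ha
  rw [hb]
  simpa using this

lemma bestArm_ne_zero (hK : 3 ≤ K) (θ : Instance K) : bestArm θ ≠ 0 :=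
  (isBestRegular_bestArm hK θ).1.1

lemma bestArm_ne_magic (hK : 3 ≤ K) (θ : Instance K) : bestArm θ ≠ θ.1 :=
  (isBestRegular_bestArm hK θ).1.2

lemma IsBestRegular.eq {θ : Instance K} (hθ : Function.Injective θ.2) {a b : Fin K}
    (ha : IsBestRegular θ a) (hb : IsBestRegular θ b) : a = b :=
  hθ (le_antisymm (hb.2 a ha.1.1 ha.1.2) (ha.2 b hb.1.1 hb.1.2))

lemma measurableSet_isBestRegular (a : Fin K) :
    MeasurableSet {θ : Instance K | IsBestRegular θ a} := by
  have h1 : ∀ b : Fin K, MeasurableSet {θ : Instance K | b ≠ θ.1} := fun b =>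
    (measurableSet_eq_fun measurable_const measurable_fst).compl
  have h2 : ∀ b : Fin K, MeasurableSet {θ : Instance K | θ.2 b ≤ θ.2 a} := fun b =>
    measurableSet_le ((measurable_pi_apply b).comp measurable_snd)
      ((measurable_pi_apply a).comp measurable_snd)
  unfold IsBestRegular
  refine ((MeasurableSet.const _).inter (h1 a)).inter (measurableSet_setOfPred.2 (Measurable.forall fun b =>
    measurableSet_setOfPred.1 ?_))
  exact MeasurableSet.imp (.const _) (MeasurableSet.imp (h1 b) (h2 b))

lemma measurable_bestArm (hK : 3 ≤ K) : Measurable (bestArm : Instance K → Fin K) := by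
  classical
  refine measurable_to_countable' fun a => ?_
  have : (bestArm : Instance K → Fin K) ⁻¹' {a} =
      {θ | IsBestRegular θ a ∧ ∀ b < a, ¬ IsBestRegular θ b} := by
    ext θ
    have hmem : ∀ b, IsBestRegular θ b → bestArm θ ≤ b := fun b hb => by
      have hb' : b ∈ Finset.univ.filter fun a => IsBestRegular θ a := by simpa using hb
      obtain ⟨c, hc⟩ := Finset.min_of_mem hb'
      have hbc : bestArm θ = c := by
        unfold bestArm
        convert WithTop.untopD_coe (0 : Fin K) c
      rw [hbc]
      exact Finset.min_le_of_eq hb' hc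
    simp only [Set.mem_preimage, Set.mem_singleton_iff, Set.mem_ofPred_eq]
    constructor
    · rintro rfl
      exact ⟨isBestRegular_bestArm hK θ, fun b hb hb' => absurd (hmem b hb') (not_le.2 hb)⟩
    · rintro ⟨ha, hb⟩
      refine le_antisymm (hmem a ha) (not_lt.1 fun h => hb _ h (isBestRegular_bestArm hK θ))
  rw [this]
  refine (measurableSet_isBestRegular a).inter (measurableSet_setOfPred.2 (Measurable.forall fun b =>
    measurableSet_setOfPred.1 ?_))
  exact MeasurableSet.imp (.const _) (measurableSet_isBestRegular b).compl

lemma isBestRegular_swapArms {i c : Fin K} (hi : i ≠ 0) (hc : c ≠ 0) {θ : Instance K} {a : Fin K}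
    (ha : IsBestRegular θ a) : IsBestRegular (swapArms i c θ) (Equiv.swap i c a) := by
  have h0 : Equiv.swap i c 0 = 0 := Equiv.swap_apply_of_ne_of_ne hi.symm hc.symm
  refine ⟨⟨fun h => ha.1.1 ?_, fun h => ha.1.2 ?_⟩, fun b hb hb' => ?_⟩
  · exact (Equiv.swap i c).injective (h.trans h0.symm)
  · exact (Equiv.swap i c).injective h
  · rw [swapArms_snd, swapArms_snd, Equiv.swap_apply_self]
    refine ha.2 _ (fun h => hb ?_) (fun h => hb' ?_)
    · rw [← Equiv.swap_apply_self i c b, h, h0]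
    · rw [swapArms_fst, ← h, Equiv.swap_apply_self]

/-- Injectivity of the means is needed because breaking ties by the smallest index does not commute
with exchanges. It holds almost surely, so equivariance is later used only up to null sets. -/
lemma bestArm_swapArms (hK : 3 ≤ K) {i c : Fin K} (hi : i ≠ 0) (hc : c ≠ 0) {θ : Instance K}
    (hθ : Function.Injective θ.2) :
    bestArm (swapArms i c θ) = Equiv.swap i c (bestArm θ) := by
  refine IsBestRegular.eq (θ := swapArms i c θ) ?_ (isBestRegular_bestArm hK _)
    (isBestRegular_swapArms hi hc (isBestRegular_bestArm hK θ))
  intro a b hab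
  rw [swapArms_snd, swapArms_snd] at hab
  exact (Equiv.swap i c).injective (hθ hab)

lemma isProbabilityMeasure_uniformOn_ne_zero (hK : 3 ≤ K) :
    IsProbabilityMeasure (uniformOn {m : Fin K | m ≠ 0}) :=
  isProbabilityMeasure_uniformOn (Set.toFinite _)
    ⟨⟨1, by omega⟩, fun h => by simpa using congrArg Fin.val h⟩

instance isProbabilityMeasure_restrict_Icc :
    IsProbabilityMeasure ((volume : Measure ℝ).restrict (Set.Icc 0 1)) :=
  ⟨by simp⟩

lemma isProbabilityMeasure_prior (hK : 3 ≤ K) : IsProbabilityMeasure (prior K) := by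
  have := isProbabilityMeasure_uniformOn_ne_zero hK
  unfold prior
  infer_instance

lemma isProbabilityMeasure_law (hK : 3 ≤ K) : IsProbabilityMeasure (law K) := by
  have := isProbabilityMeasure_prior hK
  unfold law
  infer_instance

lemma measurePreserving_swapArms {i c : Fin K} (hi : i ≠ 0) (hc : c ≠ 0) :
    MeasurePreserving (swapArms i c) (prior K) (prior K) := by
  have h0 : Equiv.swap i c 0 = 0 := Equiv.swap_apply_of_ne_of_ne hi.symm hc.symm
  have h1 : MeasurePreserving (Equiv.swap i c) (uniformOn {m : Fin K | m ≠ 0})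
      (uniformOn {m : Fin K | m ≠ 0}) := by
    refine ⟨measurable_of_finite _, ?_⟩
    ext s hs
    rw [Measure.map_apply (measurable_of_finite _) hs, uniformOn,
      cond_apply (Set.toFinite _).measurableSet, cond_apply (Set.toFinite _).measurableSet]
    congr 1
    have : {m : Fin K | m ≠ 0} ∩ (Equiv.swap i c) ⁻¹' s =
        (Equiv.swap i c) '' ({m : Fin K | m ≠ 0} ∩ s) := by
      ext m
      rw [Equiv.image_eq_preimage_symm, Equiv.symm_swap]
      simp only [Set.mem_inter_iff, Set.mem_ofPred_eq, Set.mem_preimage, and_congr_left_iff]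
      intro _
      rw [not_iff_not]
      exact ⟨fun h => by rw [h, h0], fun h => (Equiv.swap i c).injective (h.trans h0.symm)⟩
    rw [this, Measure.count_injective_image (Equiv.swap i c).injective]
  exact h1.prod (measurePreserving_piCongrLeft
    (fun _ : Fin K => (volume : Measure ℝ).restrict (Set.Icc 0 1)) (Equiv.swap i c))

/-- A tie between two given arms confines the means to a proper linear subspace, which is Lebesgue
null. -/
lemma ae_injective_prior : ∀ᵐ θ ∂(prior K), Function.Injective θ.2 := by
  have key : ∀ᵐ μ ∂(Measure.pi fun _ : Fin K => (volume : Measure ℝ).restrict (Set.Icc 0 1)),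
      Function.Injective μ := by
    rw [← Measure.restrict_pi_pi]
    refine ae_restrict_of_ae ?_
    have h : ∀ a b : Fin K, a ≠ b → ∀ᵐ μ ∂(Measure.pi fun _ : Fin K => (volume : Measure ℝ)),
        μ a ≠ μ b := by
      intro a b hab
      let p : Submodule ℝ (Fin K → ℝ) :=
        LinearMap.ker (LinearMap.proj (R := ℝ) (φ := fun _ : Fin K => ℝ) a - LinearMap.proj b)
      have hp : p ≠ ⊤ := by
        intro h
        have : Pi.single a (1 : ℝ) ∈ p := h ▸ Submodule.mem_top
        simp [p, hab.symm] at this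
      have h0 := Measure.addHaar_submodule (volume : Measure (Fin K → ℝ)) p hp
      have hset : {μ : Fin K → ℝ | ¬ μ a ≠ μ b} = (p : Set (Fin K → ℝ)) := by
        ext μ
        simp [p, sub_eq_zero]
      rw [ae_iff, hset]
      exact h0
    have h' := ae_all_iff.2 fun a : Fin K => ae_all_iff.2 fun b : Fin K =>
      (ae_all_iff.2 fun hab : a ≠ b => h a b hab)
    filter_upwards [h'] with μ hμ a b hab
    by_contra hne
    exact hμ a b hne hab
  unfold prior
  exact Measure.quasiMeasurePreserving_snd.ae key

lemma prior_fst_preimage (hK : 3 ≤ K) (s : Set (Fin K)) :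
    prior K {θ | θ.1 ∈ s} = uniformOn {m : Fin K | m ≠ 0} s := by
  have := isProbabilityMeasure_uniformOn_ne_zero hK
  have h : {θ : Instance K | θ.1 ∈ s} = s ×ˢ Set.univ := by ext; simp
  rw [h, prior, Measure.prod_prod, measure_univ, mul_one]

lemma ae_magic_ne_zero (hK : 3 ≤ K) : ∀ᵐ θ ∂(prior K), θ.1 ≠ 0 := by
  rw [ae_iff]
  have := prior_fst_preimage hK {0}
  simp only [Set.mem_singleton_iff] at this
  simp only [ne_eq, not_not, this]
  rw [uniformOn_eq_zero_iff (Set.toFinite _)]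
  ext; simp

lemma prior_magic_eq (hK : 3 ≤ K) {j : Fin K} (hj : j ≠ 0) :
    (prior K).real {θ | θ.1 = j} = 1 / ((K : ℝ) - 1) := by
  classical
  have h := prior_fst_preimage hK {j}
  simp only [Set.mem_singleton_iff] at h
  rw [measureReal_def, h]
  have h1 : {m : Fin K | m ≠ 0} = ((Finset.univ.erase (0 : Fin K) : Finset (Fin K)) : Set _) := by
    ext; simp
  have h2 : ({j} : Set (Fin K)) = (({j} : Finset (Fin K)) : Set _) := by simp
  rw [h1, h2, uniformOn_apply_finset]
  have h3 : (Finset.univ.erase (0 : Fin K)) ∩ {j} = {j} := by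
    ext a; simp; rintro rfl; exact hj
  rw [h3, Finset.card_erase_of_mem (Finset.mem_univ _)]
  rw [Finset.card_singleton, Finset.card_univ, Fintype.card_fin, ENNReal.toReal_div,
    ENNReal.toReal_natCast, ENNReal.toReal_natCast, Nat.cast_sub (by omega)]
  simp

/-! ### Entropy -/

lemma entropy_nonneg {K : ℕ} (p : Measure (Fin K)) [IsProbabilityMeasure p] : 0 ≤ entropy p :=
  Finset.sum_nonneg fun _ _ => Real.negMulLog_nonneg measureReal_nonneg measureReal_le_one

lemma sum_measureReal_singleton_eq_one {K : ℕ} (p : Measure (Fin K)) [IsProbabilityMeasure p] :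
    ∑ a, p.real {a} = 1 := by
  rw [sum_measureReal_singleton]
  simp

lemma entropy_eq_log_card {K : ℕ} (p : Measure (Fin K)) [IsProbabilityMeasure p]
    (S : Finset (Fin K)) (h0 : ∀ a ∉ S, p.real {a} = 0)
    (hS : ∀ a ∈ S, ∀ b ∈ S, p.real {a} = p.real {b}) : entropy p = Real.log S.card := by
  have hsum : ∑ a ∈ S, p.real {a} = 1 := by
    rw [← sum_measureReal_singleton_eq_one p]
    exact Finset.sum_subset (Finset.subset_univ S) fun a _ ha => h0 a ha
  have hval : ∀ a ∈ S, p.real {a} = (S.card : ℝ)⁻¹ := by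
    intro a ha
    rw [Finset.sum_congr rfl fun b hb => hS b hb a ha, Finset.sum_const, nsmul_eq_mul] at hsum
    exact eq_inv_of_mul_eq_one_right hsum
  have hne : (S.card : ℝ) ≠ 0 := by
    intro h
    have : S = ∅ := by simpa using h
    simp [this] at hsum
  unfold entropy
  rw [← Finset.sum_subset (Finset.subset_univ S) fun a _ ha => by rw [h0 a ha, Real.negMulLog_zero],
    Finset.sum_congr rfl fun a ha => by rw [hval a ha], Finset.sum_const, nsmul_eq_mul,
    Real.negMulLog, Real.log_inv]
  field_simp

lemma entropy_le_log_card {K : ℕ} (p : Measure (Fin K)) [IsProbabilityMeasure p]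
    (S : Finset (Fin K)) (hS : S.Nonempty) (h0 : ∀ a ∉ S, p.real {a} = 0) :
    entropy p ≤ Real.log S.card := by
  have hsum : ∑ a ∈ S, p.real {a} = 1 := by
    rw [← sum_measureReal_singleton_eq_one p]
    exact Finset.sum_subset (Finset.subset_univ S) fun a _ ha => h0 a ha
  have hpos : (0 : ℝ) < S.card := by exact_mod_cast hS.card_pos
  have key : ∀ a ∈ S, Real.negMulLog (p.real {a}) ≤
      p.real {a} * Real.log S.card + ((S.card : ℝ)⁻¹ - p.real {a}) := by
    intro a _
    rcases (measureReal_nonneg (μ := p) (s := {a})).eq_or_lt with h | h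
    · rw [← h]; simp [hpos.le]
    -- Gibbs' inequality term by term: `log x ≤ x - 1` at the ratio of the uniform weight to `p
    -- {a}`. The corrections cancel in the sum over `S`.
    · have := Real.log_le_sub_one_of_pos (x := ((S.card : ℝ) * p.real {a})⁻¹) (by positivity)
      rw [Real.log_inv, Real.log_mul hpos.ne' h.ne'] at this
      have h2 := mul_le_mul_of_nonneg_left this h.le
      have h3 : p.real {a} * (((S.card : ℝ) * p.real {a})⁻¹ - 1) =
          (S.card : ℝ)⁻¹ - p.real {a} := by field_simp
      rw [h3] at h2
      unfold Real.negMulLog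
      linarith
  unfold entropy
  rw [← Finset.sum_subset (Finset.subset_univ S) fun a _ ha => by rw [h0 a ha, Real.negMulLog_zero]]
  refine (Finset.sum_le_sum key).trans_eq ?_
  rw [Finset.sum_add_distrib, ← Finset.sum_mul, Finset.sum_sub_distrib, hsum, Finset.sum_const,
    nsmul_eq_mul, mul_inv_cancel₀ hpos.ne']
  ring

/-! ### The information gains at the first round -/

lemma measurable_reward_arm (hK : 3 ≤ K) (φ : Fin K → ℝ) (a : Fin K) :
    Measurable fun z : Instance K × ℝ => reward φ z.1 a z.2 := by
  have hφ : Measurable φ := measurable_of_finite φ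
  have hfst : Measurable fun z : Instance K × ℝ => z.1.1 := by fun_prop
  have hμ : Measurable fun z : Instance K × ℝ => z.1.2 a := by fun_prop
  unfold reward
  refine Measurable.ite (.const _) (hφ.comp hfst)
    (Measurable.ite (measurableSet_eq_fun measurable_const hfst) ?_ (hμ.add measurable_snd))
  exact hφ.comp ((measurable_bestArm hK).comp (by fun_prop))

lemma measurable_reward (hK : 3 ≤ K) (φ : Fin K → ℝ) :
    Measurable fun z : Fin K × (Instance K × ℝ) => reward φ z.2.1 z.1 z.2.2 :=
  measurable_from_prod_countable_right fun a => measurable_reward_arm hK φ a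

lemma prior_bestArm_eq (hK : 3 ≤ K) {i c : Fin K} (hi : i ≠ 0) (hc : c ≠ 0) :
    (prior K).real {θ | bestArm θ = i} = (prior K).real {θ | bestArm θ = c} := by
  rw [measureReal_def, measureReal_def,
    ← (measurePreserving_swapArms hi hc).measure_preimage_equiv {θ | bestArm θ = c}]
  congr 1
  refine measure_congr ?_
  filter_upwards [ae_injective_prior] with θ hθ
  refine propext ?_
  change bestArm θ = i ↔ bestArm (swapArms i c θ) = c
  rw [bestArm_swapArms hK hi hc hθ, Equiv.swap_apply_eq_iff, Equiv.swap_apply_right]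

lemma prior_magic_bestArm_eq (hK : 3 ≤ K) {i c j : Fin K} (hi : i ≠ 0) (hc : c ≠ 0)
    (hij : i ≠ j) (hcj : c ≠ j) :
    prior K {θ | θ.1 = j ∧ bestArm θ = i} = prior K {θ | θ.1 = j ∧ bestArm θ = c} := by
  rw [← (measurePreserving_swapArms hi hc).measure_preimage_equiv {θ | θ.1 = j ∧ bestArm θ = c}]
  refine measure_congr ?_
  filter_upwards [ae_injective_prior] with θ hθ
  refine propext ?_
  change θ.1 = j ∧ bestArm θ = i ↔ (swapArms i c θ).1 = j ∧ bestArm (swapArms i c θ) = c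
  rw [bestArm_swapArms hK hi hc hθ, Equiv.swap_apply_eq_iff, Equiv.swap_apply_right, swapArms_fst,
    Equiv.swap_apply_eq_iff, Equiv.swap_apply_of_ne_of_ne hij.symm hcj.symm]

lemma entropy_prior_bestArm (hK : 3 ≤ K) :
    entropy ((prior K).map bestArm) = Real.log ((K : ℝ) - 1) := by
  have := isProbabilityMeasure_prior hK
  have hm := measurable_bestArm hK
  have : IsProbabilityMeasure ((prior K).map bestArm) :=
    Measure.isProbabilityMeasure_map hm.aemeasurable
  have hmap : ∀ a, ((prior K).map bestArm).real {a} = (prior K).real {θ | bestArm θ = a} :=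
    fun a => map_measureReal_apply hm (measurableSet_singleton a)
  rw [entropy_eq_log_card _ (Finset.univ.erase 0)]
  · rw [Finset.card_erase_of_mem (Finset.mem_univ _), Finset.card_univ, Fintype.card_fin,
      Nat.cast_sub (by omega), Nat.cast_one]
  · intro a ha
    have ha : a = 0 := by simpa using ha
    subst ha
    rw [hmap]
    have : {θ : Instance K | bestArm θ = 0} = ∅ :=
      Set.eq_empty_of_forall_notMem fun θ hθ => bestArm_ne_zero hK θ hθ
    rw [this, measureReal_empty]
  · intro a ha b hb
    rw [hmap, hmap]
    exact prior_bestArm_eq hK (Finset.ne_of_mem_erase ha) (Finset.ne_of_mem_erase hb)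

/-- `condDistrib` is canonical only almost everywhere, but at an atom of the reward it must be the
elementary conditional probability. Magic rewards are such atoms. -/
lemma condDistrib_bestArm_apply (hK : 3 ≤ K) (φ : Fin K → ℝ) (a : Fin K) (y : ℝ)
    (hy : (prior K).prod (gaussianReal 0 1) {z | reward φ z.1 a z.2 = y} ≠ 0) (i : Fin K) :
    condDistrib (fun z : Instance K × ℝ => bestArm z.1) (fun z => reward φ z.1 a z.2)
        ((prior K).prod (gaussianReal 0 1)) y {i} =
      ((prior K).prod (gaussianReal 0 1) {z | reward φ z.1 a z.2 = y})⁻¹ *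
        (prior K).prod (gaussianReal 0 1) {z | reward φ z.1 a z.2 = y ∧ bestArm z.1 = i} := by
  have hY := measurable_reward_arm hK φ a
  have hA : Measurable fun z : Instance K × ℝ => bestArm z.1 :=
    (measurable_bestArm hK).comp measurable_fst
  have h1 : ((prior K).prod (gaussianReal 0 1)).map (fun z => reward φ z.1 a z.2) {y} =
      (prior K).prod (gaussianReal 0 1) {z | reward φ z.1 a z.2 = y} :=
    Measure.map_apply hY (measurableSet_singleton y)
  rw [condDistrib_apply_of_ne_zero hA y (by rwa [h1]), h1,
    Measure.map_apply (hY.prodMk hA)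
      ((measurableSet_singleton y).prod (measurableSet_singleton i))]
  congr 2

lemma prod_gaussian_fst (s : Set (Instance K)) :
    (prior K).prod (gaussianReal 0 1) {z | z.1 ∈ s} = prior K s := by
  have : {z : Instance K × ℝ | z.1 ∈ s} = s ×ˢ Set.univ := by ext; simp
  rw [this, Measure.prod_prod, measure_univ, mul_one]

/-- The reward of arm `0` determines `m` and nothing else. Given `m`, exchanges fixing `m` make the
best arm uniform on the `K - 2` regular arms. -/
lemma infoGain_zero (hK : 3 ≤ K) (φ : Fin K → ℝ) (hφ : Function.Injective φ) :
    infoGain φ (prior K) 0 = Real.log ((K : ℝ) - 1) - Real.log ((K : ℝ) - 2) := by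
  have := isProbabilityMeasure_prior hK
  unfold infoGain
  simp only
  rw [entropy_prior_bestArm hK]
  congr 1
  have hent : ∀ᵐ z ∂((prior K).prod (gaussianReal 0 1)),
      entropy (condDistrib (fun z : Instance K × ℝ => bestArm z.1)
        (fun z => reward φ z.1 0 z.2) ((prior K).prod (gaussianReal 0 1))
        (reward φ z.1 0 z.2)) = Real.log ((K : ℝ) - 2) := by
    filter_upwards [Measure.quasiMeasurePreserving_fst.ae (ae_magic_ne_zero hK)] with z hz
    have hr : ∀ w : Instance K × ℝ, reward φ w.1 0 w.2 = reward φ z.1 0 z.2 ↔ w.1.1 = z.1.1 := by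
      intro w
      simp only [reward, if_true]
      exact hφ.eq_iff
    have hset : {w : Instance K × ℝ | reward φ w.1 0 w.2 = reward φ z.1 0 z.2} =
        {w | w.1 ∈ {θ : Instance K | θ.1 = z.1.1}} := by
      ext w; exact hr w
    have hne : (prior K).prod (gaussianReal 0 1)
        {w | reward φ w.1 0 w.2 = reward φ z.1 0 z.2} ≠ 0 := by
      rw [hset, prod_gaussian_fst]
      intro h
      have h1 := prior_magic_eq hK hz
      rw [measureReal_def, h] at h1
      have : (3 : ℝ) ≤ K := by exact_mod_cast hK
      have h2 : (0 : ℝ) < 1 / ((K : ℝ) - 1) := by apply one_div_pos.2; linarith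
      simp only [ENNReal.toReal_zero] at h1
      linarith
    have hap := condDistrib_bestArm_apply hK φ 0 _ hne
    have hset2 : ∀ i, {w : Instance K × ℝ | reward φ w.1 0 w.2 = reward φ z.1 0 z.2 ∧
        bestArm w.1 = i} = {w | w.1 ∈ {θ : Instance K | θ.1 = z.1.1 ∧ bestArm θ = i}} := by
      intro i; ext w; exact and_congr_left fun _ => hr w
    rw [entropy_eq_log_card _ ((Finset.univ.erase 0).erase z.1.1)]
    · rw [Finset.card_erase_of_mem (by simpa using hz),
        Finset.card_erase_of_mem (Finset.mem_univ _), Finset.card_univ, Fintype.card_fin,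
        Nat.sub_sub, Nat.cast_sub (by omega)]
      norm_num
    · intro i hi
      rw [measureReal_def, hap, hset2, prod_gaussian_fst]
      have : {θ : Instance K | θ.1 = z.1.1 ∧ bestArm θ = i} = ∅ := by
        refine Set.eq_empty_of_forall_notMem fun θ hθ => hi ?_
        have h1 := bestArm_ne_magic hK θ
        have h2 := bestArm_ne_zero hK θ
        rw [hθ.2] at h1 h2
        rw [hθ.1] at h1
        simp [h1, h2]
      simp [this]
    · intro i hi c hc
      simp only [Finset.mem_erase, Finset.mem_univ, and_true] at hi hc
      rw [measureReal_def, measureReal_def, hap, hap, hset2, hset2, prod_gaussian_fst,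
        prod_gaussian_fst, prior_magic_bestArm_eq hK hi.2 hc.2 hi.1 hc.1]
  rw [integral_congr_ae hent]
  simp

lemma ae_add_gaussian_ne (a : Fin K) (y : ℝ) :
    ∀ᵐ z ∂((prior K).prod (gaussianReal 0 1)), z.1.2 a + z.2 ≠ y := by
  have hmeas : MeasurableSet {z : Instance K × ℝ | z.1.2 a + z.2 ≠ y} := by
    refine (measurableSet_eq_fun ?_ measurable_const).compl
    exact ((measurable_pi_apply a).comp (measurable_snd.comp measurable_fst)).add measurable_snd
  rw [Measure.ae_prod_iff_ae_ae hmeas]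
  refine Filter.Eventually.of_forall fun θ => ?_
  have : NullSingletonClass (gaussianReal 0 1) :=
    nullSingletonClass_gaussianReal one_ne_zero
  rw [ae_iff]
  refine measure_mono_null (t := {y - θ.2 a}) ?_ (measure_singleton _)
  intro x hx
  have hx : θ.2 a + x = y := by simpa using hx
  simp [← hx]

/-- The remaining entropy is bounded by `0` on the event that `a` is magic and by `log (K-1)`
elsewhere; the event has mass `1/(K-1)`. -/
lemma le_infoGain (hK : 3 ≤ K) (φ : Fin K → ℝ) (hφ : Function.Injective φ) {a : Fin K}
    (ha : a ≠ 0) :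
    Real.log ((K : ℝ) - 1) / ((K : ℝ) - 1) ≤ infoGain φ (prior K) a := by
  have := isProbabilityMeasure_prior hK
  have hA : Measurable fun z : Instance K × ℝ => bestArm z.1 :=
    (measurable_bestArm hK).comp measurable_fst
  have hY := measurable_reward_arm hK φ a
  have hKr : (3 : ℝ) ≤ K := by exact_mod_cast hK
  unfold infoGain
  simp only
  rw [entropy_prior_bestArm hK]
  set J := (prior K).prod (gaussianReal 0 1) with hJ
  set κ := condDistrib (fun z : Instance K × ℝ => bestArm z.1)
    (fun z => reward φ z.1 a z.2) J with hκ
  -- The conditional law almost surely does not charge arm `0`, so its entropy is at most `log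
  -- (K-1)` rather than `log K`.
  have hzero : ∀ᵐ z ∂J, κ (reward φ z.1 a z.2) {0} = 0 := by
    have h := setLIntegral_condDistrib_of_measurableSet (μ := J) hY hA.aemeasurable
      (measurableSet_singleton (0 : Fin K)) (t := Set.univ) ⟨Set.univ, .univ, rfl⟩
    have h0 : (fun z : Instance K × ℝ => bestArm z.1) ⁻¹' {0} = ∅ :=
      Set.eq_empty_of_forall_notMem fun z hz => bestArm_ne_zero hK z.1 hz
    rw [h0, Set.inter_empty, measure_empty, Measure.restrict_univ, lintegral_eq_zero_iff] at h
    · exact h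
    · exact (Kernel.measurable_coe κ (measurableSet_singleton 0)).comp hY
  have hmagic : ∀ᵐ z ∂J, z.1.1 = a → entropy (κ (reward φ z.1 a z.2)) = 0 := by
    have hi : ∀ i : Fin K, ∀ᵐ z ∂J, reward φ z.1 a z.2 = φ i → entropy (κ (φ i)) = 0 := by
      intro i
      by_cases hne : J {z | reward φ z.1 a z.2 = φ i} = 0
      · have : ∀ᵐ z ∂J, ¬ reward φ z.1 a z.2 = φ i := by
          rw [ae_iff]; simpa using hne
        filter_upwards [this] with z hz h using absurd h hz
      · refine Filter.Eventually.of_forall fun z _ => ?_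
        have hap := condDistrib_bestArm_apply hK φ a _ hne
        rw [entropy_eq_log_card _ {i}]
        · simp
        · intro b hb
          have hb : b ≠ i := by simpa using hb
          rw [measureReal_def, hκ, hap]
          -- A regular arm hits the value `φ i` with probability zero because the noise has no
          -- atoms. So this reward must come from the magic arm, which forces the best arm to be
          -- `i`.
          have : J {z | reward φ z.1 a z.2 = φ i ∧ bestArm z.1 = b} = 0 := by
            refine measure_mono_null ?_ (ae_iff.1 (ae_add_gaussian_ne (K := K) a (φ i)))
            rintro w ⟨hw, hwb⟩
            simp only [Set.mem_ofPred_eq, ne_eq, not_not]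
            by_cases hwa : a = w.1.1
            · rw [reward, if_neg ha, if_pos hwa, hwb] at hw
              exact absurd (hφ hw) hb
            · rwa [reward, if_neg ha, if_neg hwa] at hw
          rw [← hJ, this]; simp
        · intro b hb c hc
          rw [Finset.mem_singleton.1 hb, Finset.mem_singleton.1 hc]
    filter_upwards [ae_all_iff.2 hi] with z hz hza
    have hr : reward φ z.1 a z.2 = φ (bestArm z.1) := by
      simp [reward, ha, hza]
    rw [hr]
    exact hz _ hr
  have hmeas : MeasurableSet {z : Instance K × ℝ | z.1 ∈ {θ : Instance K | θ.1 = a}} :=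
    measurableSet_eq_fun (measurable_fst.comp measurable_fst) measurable_const
  have hle : ∫ z, entropy (κ (reward φ z.1 a z.2)) ∂J ≤
      ∫ z, {z : Instance K × ℝ | z.1 ∈ {θ : Instance K | θ.1 = a}}ᶜ.indicator
        (fun _ => Real.log ((K : ℝ) - 1)) z ∂J := by
    refine integral_mono_of_nonneg (Filter.Eventually.of_forall fun z => entropy_nonneg _)
      ((integrable_const _).indicator hmeas.compl) ?_
    filter_upwards [hzero, hmagic] with z hz hm
    by_cases hza : z.1.1 = a
    · rw [hm hza, Set.indicator_of_notMem (by simpa using hza)]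
    · rw [Set.indicator_of_mem (by simpa using hza)]
      have h := entropy_le_log_card (κ (reward φ z.1 a z.2)) (Finset.univ.erase 0)
        ⟨a, by simpa using ha⟩ (fun b hb => by
          have hb : b = 0 := by simpa using hb
          rw [hb, measureReal_def, hz, ENNReal.toReal_zero])
      rwa [Finset.card_erase_of_mem (Finset.mem_univ _), Finset.card_univ, Fintype.card_fin,
        Nat.cast_sub (by omega), Nat.cast_one] at h
  have hmass : J.real {z : Instance K × ℝ | z.1 ∈ {θ : Instance K | θ.1 = a}} =
      1 / ((K : ℝ) - 1) := by
    rw [measureReal_def, hJ, prod_gaussian_fst, ← measureReal_def, prior_magic_eq hK ha]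
  rw [integral_indicator_const _ hmeas.compl, probReal_compl_eq_one_sub hmeas, hmass,
    smul_eq_mul] at hle
  have : (1 - 1 / ((K : ℝ) - 1)) * Real.log ((K : ℝ) - 1) =
      Real.log ((K : ℝ) - 1) - Real.log ((K : ℝ) - 1) / ((K : ℝ) - 1) := by ring
  linarith

lemma infoGain_zero_lt (hK : 7 ≤ K) (φ : Fin K → ℝ) (hφ : Function.Injective φ) {a : Fin K}
    (ha : a ≠ 0) : infoGain φ (prior K) 0 < infoGain φ (prior K) a := by
  refine lt_of_lt_of_le ?_ (le_infoGain (by omega) φ hφ ha)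
  rw [infoGain_zero (by omega) φ hφ]
  have hKr : (7 : ℝ) ≤ K := by exact_mod_cast hK
  have h1 : (0 : ℝ) < (K : ℝ) - 1 := by linarith
  have h2 : (0 : ℝ) < (K : ℝ) - 2 := by linarith
  rw [← Real.log_div h1.ne' h2.ne']
  have h3 : Real.log (((K : ℝ) - 1) / ((K : ℝ) - 2)) ≤ 1 / ((K : ℝ) - 2) := by
    refine (Real.log_le_sub_one_of_pos (div_pos h1 h2)).trans_eq ?_
    field_simp
    ring
  refine h3.trans_lt ?_
  -- It remains to see that `(K-1)/(K-2) < log (K-1)`. For `K ≥ 7` the left side is at most `6/5`,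
  -- while `2 log 2 > 1.38`.
  have h4 : 2 * Real.log 2 ≤ Real.log ((K : ℝ) - 1) := by
    have h := Real.log_le_log (x := 2 ^ 2) (by norm_num) (show (2 : ℝ) ^ 2 ≤ (K : ℝ) - 1 by linarith)
    rwa [Real.log_pow, Nat.cast_ofNat] at h
  have h5 := Real.log_two_gt_d9
  rw [div_lt_div_iff₀ h2 h1]
  nlinarith

/-! ### Histories and their behaviour under an exchange of arms -/

lemma measurable_history_action (hK : 3 ≤ K) (φ : Fin K → ℝ) (π : Policy K) (n : ℕ) :
    Measurable (history φ π n) ∧ Measurable (action φ π n) := by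
  have hact : ∀ n, Measurable (history φ π n) → Measurable (action φ π n) := fun n h =>
    (π.measurable_act n).comp
      (h.prodMk ((measurable_pi_apply n).comp (measurable_snd.comp measurable_snd)))
  suffices h : ∀ n, Measurable (history φ π n) from ⟨h n, hact n (h n)⟩
  intro n
  induction n with
  | zero => exact measurable_pi_iff.2 fun i => i.elim0
  | succ n ih =>
    refine measurable_pi_iff.2 fun k => ?_
    refine Fin.lastCases ?_ (fun j => ?_) k
    · have : (fun ω => history φ π (n + 1) ω (Fin.last n)) =
          fun ω => (action φ π n ω, reward φ ω.1 (action φ π n ω) (ω.2.1 n)) := by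
        funext ω
        exact Fin.snoc_last (α := fun _ => Fin K × ℝ) _ _
      rw [this]
      refine (hact n ih).prodMk ?_
      refine (measurable_reward hK φ).comp ((hact n ih).prodMk (measurable_fst.prodMk ?_))
      exact (measurable_pi_apply n).comp (measurable_fst.comp measurable_snd)
    · have : (fun ω => history φ π (n + 1) ω j.castSucc) = fun ω => history φ π n ω j := by
        funext ω
        exact Fin.snoc_castSucc (α := fun _ => Fin K × ℝ) _ _ _
      rw [this]
      exact (measurable_pi_apply j).comp ih

lemma measurable_history (hK : 3 ≤ K) (φ : Fin K → ℝ) (π : Policy K) (n : ℕ) :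
    Measurable (history φ π n) := (measurable_history_action hK φ π n).1

lemma measurable_action (hK : 3 ≤ K) (φ : Fin K → ℝ) (π : Policy K) (n : ℕ) :
    Measurable (action φ π n) := (measurable_history_action hK φ π n).2

lemma law_fst_preimage (s : Set (Instance K)) : law K {ω | ω.1 ∈ s} = prior K s := by
  have : {ω : Outcome K | ω.1 ∈ s} = s ×ˢ Set.univ := by ext; simp
  rw [this, law, Measure.prod_prod, measure_univ, mul_one]

lemma ae_injective_law : ∀ᵐ ω ∂(law K), Function.Injective ω.1.2 :=
  Measure.quasiMeasurePreserving_fst.ae ae_injective_prior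

lemma ae_magic_ne_zero_law (hK : 3 ≤ K) : ∀ᵐ ω ∂(law K), ω.1.1 ≠ 0 :=
  Measure.quasiMeasurePreserving_fst.ae (ae_magic_ne_zero hK)

/-- The empty history is an atom of mass one, so the conditional law is determined there pointwise
and equals the prior. -/
lemma posterior_zero (hK : 3 ≤ K) (φ : Fin K → ℝ) (π : Policy K) (h : History K 0) :
    posterior φ π 0 h = prior K := by
  have := isProbabilityMeasure_law hK
  have hpre : history φ π 0 ⁻¹' {h} = Set.univ := by
    ext ω; simpa using Subsingleton.elim _ _
  have h1 : (law K).map (history φ π 0) {h} = 1 := by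
    rw [Measure.map_apply (measurable_history hK φ π 0) (measurableSet_singleton h), hpre,
      measure_univ]
  ext s hs
  rw [posterior, condDistrib_apply_of_ne_zero measurable_fst h (by simp [h1]), h1, inv_one,
    one_mul, Measure.map_apply ((measurable_history hK φ π 0).prodMk measurable_fst)
      ((measurableSet_singleton h).prod hs), ← law_fst_preimage]
  congr 1
  ext ω
  simpa using fun _ => Subsingleton.elim _ _

lemma IsMyopicIDS.ae_action_zero_ne_zero (hK : 7 ≤ K) {φ : Fin K → ℝ}
    (hφ : Function.Injective φ) {π : Policy K} (hπ : IsMyopicIDS φ π) :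
    ∀ᵐ ω ∂(law K), action φ π 0 ω ≠ 0 := by
  filter_upwards [hπ 0] with ω hω h0
  have h1 : (⟨1, by omega⟩ : Fin K) ≠ 0 := fun h => by simpa using congrArg Fin.val h
  have h := hω ⟨1, by omega⟩
  have hg : ∀ b, infoGain φ (posterior φ π 0 (history φ π 0 ω)) b = infoGain φ (prior K) b := by
    intro b
    congr 1
    exact posterior_zero (by omega) φ π _
  rw [hg, hg, h0] at h
  exact absurd (infoGain_zero_lt hK φ hφ h1) (not_lt.2 h)

/-- The outcome in which the arms `i` and `c` exchange their roles. -/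
def swapOutcome (i c : Fin K) : Outcome K ≃ᵐ Outcome K :=
  MeasurableEquiv.prodCongr (swapArms i c) (MeasurableEquiv.refl _)

lemma swapOutcome_fst {K : ℕ} (i c : Fin K) (ω : Outcome K) :
    (swapOutcome i c ω).1 = swapArms i c ω.1 := rfl

lemma swapOutcome_snd {K : ℕ} (i c : Fin K) (ω : Outcome K) : (swapOutcome i c ω).2 = ω.2 := rfl

lemma measurePreserving_swapOutcome {i c : Fin K} (hi : i ≠ 0) (hc : c ≠ 0) :
    MeasurePreserving (swapOutcome i c) (law K) (law K) :=
  (measurePreserving_swapArms hi hc).prod (MeasurePreserving.id _)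

/-- Arm `0` answers `φ m`, so it is blind to the exchange only when the exchange fixes `m`; arm `m`
is excluded because its reward names the best arm. -/
lemma reward_swapArms (φ : Fin K → ℝ) {i c a : Fin K} {θ : Instance K} (hai : a ≠ i) (hac : a ≠ c)
    (hm : a ≠ θ.1) (h0 : a = 0 → θ.1 ≠ i ∧ θ.1 ≠ c) (ξ : ℝ) :
    reward φ (swapArms i c θ) a ξ = reward φ θ a ξ := by
  have hfix : Equiv.swap i c a = a := Equiv.swap_apply_of_ne_of_ne hai hac
  unfold reward
  by_cases ha : a = 0
  · rw [if_pos ha, if_pos ha, swapArms_fst, Equiv.swap_apply_of_ne_of_ne (h0 ha).1 (h0 ha).2]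
  · have hm' : a ≠ (swapArms i c θ).1 := fun h => hm (by
      rw [swapArms_fst, ← hfix] at h
      exact (Equiv.swap i c).injective h)
    rw [if_neg ha, if_neg ha, if_neg hm, if_neg hm', swapArms_snd, hfix]

/-- The policy sees only the past and its seeds. By induction it makes the same query in both
outcomes and, as the queried arm is blind to the exchange, gets the same reward. -/
lemma history_swapOutcome (φ : Fin K → ℝ) (π : Policy K) {i c : Fin K} {ω : Outcome K} (n : ℕ)
    (h : ∀ k < n, action φ π k ω ≠ i ∧ action φ π k ω ≠ c ∧ action φ π k ω ≠ ω.1.1 ∧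
      (action φ π k ω = 0 → ω.1.1 ≠ i ∧ ω.1.1 ≠ c)) :
    history φ π n (swapOutcome i c ω) = history φ π n ω := by
  induction n with
  | zero => rfl
  | succ n ih =>
    have hn := ih fun k hk => h k (by omega)
    obtain ⟨h1, h2, h3, h4⟩ := h n (by omega)
    have ha : action φ π n (swapOutcome i c ω) = action φ π n ω := by
      unfold action
      rw [hn, swapOutcome_snd]
    change Fin.snoc (α := fun _ => Fin K × ℝ) (history φ π n (swapOutcome i c ω))
      (action φ π n (swapOutcome i c ω), reward φ (swapOutcome i c ω).1
        (action φ π n (swapOutcome i c ω)) ((swapOutcome i c ω).2.1 n)) =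
      Fin.snoc (α := fun _ => Fin K × ℝ) (history φ π n ω)
      (action φ π n ω, reward φ ω.1 (action φ π n ω) (ω.2.1 n))
    rw [ha, hn, swapOutcome_fst, swapOutcome_snd, reward_swapArms φ h1 h2 h3 h4]

lemma action_swapOutcome (φ : Fin K → ℝ) (π : Policy K) {i c : Fin K} {ω : Outcome K} (n : ℕ)
    (h : ∀ k < n, action φ π k ω ≠ i ∧ action φ π k ω ≠ c ∧ action φ π k ω ≠ ω.1.1 ∧
      (action φ π k ω = 0 → ω.1.1 ≠ i ∧ ω.1.1 ≠ c)) :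
    action φ π n (swapOutcome i c ω) = action φ π n ω := by
  unfold action
  rw [history_swapOutcome φ π n h, swapOutcome_snd]

/-! ### Stopping times -/

lemma stoppingTime_eq_coe_iff (φ : Fin K → ℝ) (s : Strategy K) (ω : Outcome K) (n : ℕ) :
    stoppingTime φ s ω = n ↔ history φ s.toPolicy n ω ∈ s.stopSet n ∧
      ∀ k < n, history φ s.toPolicy k ω ∉ s.stopSet k := by
  have hle : ∀ k, history φ s.toPolicy k ω ∈ s.stopSet k → stoppingTime φ s ω ≤ k :=
    fun k hk => iInf₂_le k hk
  constructor
  · intro h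
    have hno : ∀ k < n, history φ s.toPolicy k ω ∉ s.stopSet k := fun k hk hmem => by
      have := hle k hmem
      rw [h] at this
      exact absurd (Nat.cast_le.1 this) (by omega)
    refine ⟨by_contra fun hn => ?_, hno⟩
    have : ((n + 1 : ℕ) : ℕ∞) ≤ stoppingTime φ s ω := by
      refine le_iInf₂ fun k hk => ?_
      refine Nat.cast_le.2 (Nat.succ_le_of_lt (lt_of_le_of_ne (not_lt.1 fun hlt => hno k hlt hk) ?_))
      rintro rfl
      exact hn hk
    rw [h] at this
    exact absurd (Nat.cast_le.1 this) (by omega)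
  · rintro ⟨hn, hno⟩
    refine le_antisymm (hle n hn) (le_iInf₂ fun k hk => Nat.cast_le.2 (not_lt.1 fun hlt => ?_))
    exact hno k hlt hk

lemma measurableSet_stoppingTime_eq (hK : 3 ≤ K) (φ : Fin K → ℝ) (s : Strategy K) (n : ℕ) :
    MeasurableSet {ω | stoppingTime φ s ω = n} := by
  simp only [stoppingTime_eq_coe_iff]
  have hm : ∀ k, MeasurableSet {ω | history φ s.toPolicy k ω ∈ s.stopSet k} := fun k =>
    measurable_history hK φ s.toPolicy k (s.measurableSet_stopSet k)
  refine (hm n).inter (measurableSet_setOfPred.2 (Measurable.forall fun k =>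
    measurableSet_setOfPred.1 ?_))
  exact MeasurableSet.imp (.const _) (hm k).compl

lemma measurableSet_correct (hK : 3 ≤ K) (φ : Fin K → ℝ) (s : Strategy K) :
    MeasurableSet {ω | ∃ n : ℕ, stoppingTime φ s ω = n ∧
      s.guess n (history φ s.toPolicy n ω) = bestArm ω.1} := by
  refine measurableSet_setOfPred.2 (Measurable.exists fun n => measurableSet_setOfPred.1 ?_)
  refine (measurableSet_stoppingTime_eq hK φ s n).inter (measurableSet_eq_fun
    ((s.measurable_guess n).comp (measurable_history hK φ s.toPolicy n))
    ((measurable_bestArm hK).comp measurable_fst))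

lemma IsDeltaCorrect.wrong_le (hK : 3 ≤ K) {φ : Fin K → ℝ} {δ : ℝ} {s : Strategy K}
    (hs : IsDeltaCorrect φ δ s) (n : ℕ) :
    (law K).real {ω | stoppingTime φ s ω = n ∧
      s.guess n (history φ s.toPolicy n ω) ≠ bestArm ω.1} ≤ δ := by
  have := isProbabilityMeasure_law hK
  have h := probReal_compl_eq_one_sub (μ := law K) (measurableSet_correct hK φ s)
  have hsub : {ω | stoppingTime φ s ω = n ∧
      s.guess n (history φ s.toPolicy n ω) ≠ bestArm ω.1} ⊆
      {ω | ∃ n : ℕ, stoppingTime φ s ω = n ∧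
        s.guess n (history φ s.toPolicy n ω) = bestArm ω.1}ᶜ := by
    rintro ω ⟨hn, hg⟩ ⟨k, hk, hgk⟩
    rw [hn] at hk
    obtain rfl : n = k := by exact_mod_cast hk
    exact hg hgk
  have h' := measureReal_mono (μ := law K) hsub
  unfold IsDeltaCorrect at hs
  linarith

/-- If the best arm and another arm are still exchangeable when the strategy stops, then it is
wrong with probability at least one half. -/
lemma IsDeltaCorrect.exchangeable_le (hK : 3 ≤ K) {φ : Fin K → ℝ} {δ : ℝ} {s : Strategy K}
    (hs : IsDeltaCorrect φ δ s) (n : ℕ) (i c : Fin K) :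
    (law K).real {ω | stoppingTime φ s ω = n ∧ bestArm ω.1 = i ∧ c ≠ 0 ∧ c ≠ i ∧ c ≠ ω.1.1 ∧
      ∀ k < n, action φ s.toPolicy k ω ≠ i ∧ action φ s.toPolicy k ω ≠ c ∧
        action φ s.toPolicy k ω ≠ ω.1.1} ≤ 2 * δ := by
  have := isProbabilityMeasure_law hK
  have hw := hs.wrong_le hK n
  have hδ : 0 ≤ δ := measureReal_nonneg.trans hw
  set W := {ω | stoppingTime φ s ω = n ∧
      s.guess n (history φ s.toPolicy n ω) ≠ bestArm ω.1} with hW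
  by_cases hi : i = 0
  · rw [Set.eq_empty_of_forall_notMem (s := {ω | _}), measureReal_empty]
    · linarith
    · rintro ω ⟨-, h, -⟩
      exact bestArm_ne_zero hK _ (h.trans hi)
  by_cases hc : c = 0
  · rw [Set.eq_empty_of_forall_notMem (s := {ω | _}), measureReal_empty]
    · linarith
    · rintro ω ⟨-, -, h, -⟩
      exact h hc
  have hpre : (law K).real (swapOutcome i c ⁻¹' W) = (law K).real W := by
    rw [measureReal_def, measureReal_def,
      (measurePreserving_swapOutcome hi hc).measure_preimage_equiv]
  have hN : (law K).real {ω | ¬ Function.Injective ω.1.2} = 0 := by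
    rw [measureReal_def, ae_iff.1 ae_injective_law, ENNReal.toReal_zero]
  -- Exchanging `i` and `c` leaves the history, hence the guess, unchanged but moves the best arm
  -- from `i` to `c`. A correct guess in one outcome is wrong in the other, so two copies of the
  -- error event, each of mass at most `δ`, cover this one.
  have hsub : {ω | stoppingTime φ s ω = n ∧ bestArm ω.1 = i ∧ c ≠ 0 ∧ c ≠ i ∧ c ≠ ω.1.1 ∧
      ∀ k < n, action φ s.toPolicy k ω ≠ i ∧ action φ s.toPolicy k ω ≠ c ∧
        action φ s.toPolicy k ω ≠ ω.1.1} ⊆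
      (W ∪ swapOutcome i c ⁻¹' W) ∪ {ω | ¬ Function.Injective ω.1.2} := by
    rintro ω ⟨hn, hbi, -, hci, hcm, hact⟩
    by_cases hinj : Function.Injective ω.1.2
    swap
    · exact Or.inr hinj
    left
    by_cases hg : s.guess n (history φ s.toPolicy n ω) = bestArm ω.1
    swap
    · exact Or.inl ⟨hn, hg⟩
    right
    have him : ω.1.1 ≠ i := hbi ▸ (bestArm_ne_magic hK ω.1).symm
    have hh : ∀ k ≤ n, history φ s.toPolicy k (swapOutcome i c ω) = history φ s.toPolicy k ω :=
      fun k hk => history_swapOutcome φ s.toPolicy k fun l hl =>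
        ⟨(hact l (by omega)).1, (hact l (by omega)).2.1, (hact l (by omega)).2.2,
          fun _ => ⟨him, hcm.symm⟩⟩
    have hn' : stoppingTime φ s (swapOutcome i c ω) = n := by
      rw [stoppingTime_eq_coe_iff] at hn ⊢
      rw [hh n le_rfl]
      exact ⟨hn.1, fun k hk => by rw [hh k hk.le]; exact hn.2 k hk⟩
    refine ⟨hn', ?_⟩
    rw [hh n le_rfl, hg, swapOutcome_fst, bestArm_swapArms hK hi hc hinj, hbi,
      Equiv.swap_apply_left]
    exact hci.symm
  have h1 := measureReal_mono (μ := law K) hsub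
  have h2 := measureReal_union_le (μ := law K) (W ∪ swapOutcome i c ⁻¹' W)
    {ω | ¬ Function.Injective ω.1.2}
  have h3 := measureReal_union_le (μ := law K) W (swapOutcome i c ⁻¹' W)
  linarith

/-- The first `n` queries avoid the second magic arm and the best arm. -/
def Uninformed (φ : Fin K → ℝ) (π : Policy K) (n : ℕ) : Set (Outcome K) :=
  {ω | ∀ k < n, action φ π k ω ≠ ω.1.1 ∧ action φ π k ω ≠ bestArm ω.1}

/-- Arm `0`, `m`, the best arm and the `n` queried arms are at most `n + 3 < K` in number, so an
unqueried arm exchangeable with the best arm remains. The factor `K ^ 2` is a union bound over the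
pair. Queries of arm `0` do no harm here, since these exchanges fix `m`. -/
lemma IsDeltaCorrect.uninformed_stop_le {φ : Fin K → ℝ} {δ : ℝ} {s : Strategy K}
    (hs : IsDeltaCorrect φ δ s) (n : ℕ) (hK : n + 4 ≤ K) :
    (law K).real (Uninformed φ s.toPolicy n ∩ {ω | stoppingTime φ s ω = n}) ≤
      2 * (K : ℝ) ^ 2 * δ := by
  have := isProbabilityMeasure_law (K := K) (by omega)
  have hsub : Uninformed φ s.toPolicy n ∩ {ω | stoppingTime φ s ω = n} ⊆
      ⋃ p : Fin K × Fin K, {ω | stoppingTime φ s ω = n ∧ bestArm ω.1 = p.1 ∧ p.2 ≠ 0 ∧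
        p.2 ≠ p.1 ∧ p.2 ≠ ω.1.1 ∧ ∀ k < n, action φ s.toPolicy k ω ≠ p.1 ∧
        action φ s.toPolicy k ω ≠ p.2 ∧ action φ s.toPolicy k ω ≠ ω.1.1} := by
    rintro ω ⟨hu, hn⟩
    classical
    have hcard : (({0, ω.1.1, bestArm ω.1} : Finset (Fin K)) ∪
        (Finset.range n).image fun k => action φ s.toPolicy k ω).card <
        (Finset.univ : Finset (Fin K)).card := by
      have h1 := Finset.card_union_le ({0, ω.1.1, bestArm ω.1} : Finset (Fin K))
        ((Finset.range n).image fun k => action φ s.toPolicy k ω)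
      have h2 := Finset.card_le_three (a := (0 : Fin K)) (b := ω.1.1) (c := bestArm ω.1)
      have h3 := Finset.card_image_le (s := Finset.range n)
        (f := fun k => action φ s.toPolicy k ω)
      rw [Finset.card_range] at h3
      rw [Finset.card_univ, Fintype.card_fin]
      omega
    obtain ⟨c, -, hc⟩ := Finset.exists_mem_notMem_of_card_lt_card hcard
    simp only [Finset.mem_union, Finset.mem_insert, Finset.mem_singleton, Finset.mem_image,
      Finset.mem_range, not_or, not_exists, not_and] at hc
    refine Set.mem_iUnion.2 ⟨(bestArm ω.1, c), hn, rfl, hc.1.1, hc.1.2.2, hc.1.2.1,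
      fun k hk => ⟨(hu k hk).2, hc.2 k hk, (hu k hk).1⟩⟩
  refine (measureReal_mono hsub).trans ((measureReal_iUnion_fintype_le _).trans ?_)
  refine (Finset.sum_le_sum fun p _ => hs.exchangeable_le (by omega) n p.1 p.2).trans_eq ?_
  simp
  ring

/-! ### Probability that the first queries are uninformative -/

lemma swap_mem_iff {K : ℕ} {X : Finset (Fin K)} {b c : Fin K} (hb : b ∉ X) (hc : c ∉ X) (a : Fin K) :
    Equiv.swap b c a ∈ X ↔ a ∈ X := by
  by_cases hab : a = b
  · subst hab; simp [hb, hc]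
  by_cases hac : a = c
  · subst hac; simp [hb, hc]
  rw [Equiv.swap_apply_of_ne_of_ne hab hac]

lemma swapOutcome_swapOutcome {K : ℕ} (b c : Fin K) (ω : Outcome K) :
    swapOutcome b c (swapOutcome b c ω) = ω := by
  refine Prod.ext (Prod.ext ?_ (funext fun a => ?_)) rfl
  · rw [swapOutcome_fst, swapOutcome_fst, swapArms_fst, swapArms_fst, Equiv.swap_apply_self]
  · rw [swapOutcome_fst, swapOutcome_fst, swapArms_snd, swapArms_snd, Equiv.swap_apply_self]

/-- An arm-valued variable which is equivariant under exchanges outside `X` is uniform outside `X`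
on events which are invariant under these exchanges. -/
lemma card_mul_measureReal_eq {X : Finset (Fin K)} (h0 : 0 ∈ X) {E : Set (Outcome K)}
    (hE : MeasurableSet E)
    (hinv : ∀ b ∉ X, ∀ c ∉ X, ∀ᵐ ω ∂(law K), swapOutcome b c ω ∈ E ↔ ω ∈ E)
    {f : Outcome K → Fin K} (hf : Measurable f) (hfE : ∀ ω ∈ E, f ω ∉ X)
    (hfs : ∀ b ∉ X, ∀ c ∉ X, ∀ᵐ ω ∂(law K), f (swapOutcome b c ω) = Equiv.swap b c (f ω))
    {b : Fin K} (hb : b ∉ X) :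
    (Xᶜ.card : ℝ) * (law K).real (E ∩ {ω | f ω = b}) = (law K).real E := by
  have hne : ∀ c ∉ X, c ≠ 0 := fun c hc h => hc (h ▸ h0)
  have heq : ∀ c ∈ Xᶜ, (law K).real (E ∩ {ω | f ω = c}) = (law K).real (E ∩ {ω | f ω = b}) := by
    intro c hc
    have hc : c ∉ X := Finset.mem_compl.1 hc
    rw [measureReal_def, measureReal_def, ← (measurePreserving_swapOutcome (hne b hb)
      (hne c hc)).measure_preimage_equiv (E ∩ {ω | f ω = b})]
    congr 1
    refine measure_congr ?_
    filter_upwards [hinv b hb c hc, hfs b hb c hc] with ω h1 h2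
    refine propext ?_
    change ω ∈ E ∧ f ω = c ↔ swapOutcome b c ω ∈ E ∧ f (swapOutcome b c ω) = b
    rw [h1, h2, Equiv.swap_apply_eq_iff, Equiv.swap_apply_left]
  have hU : E = ⋃ c ∈ Xᶜ, E ∩ {ω | f ω = c} := by
    ext ω
    simp only [Set.mem_iUnion, Set.mem_inter_iff, exists_prop]
    exact ⟨fun h => ⟨f ω, Finset.mem_compl.2 (hfE ω h), h, rfl⟩, fun ⟨_, _, h, _⟩ => h⟩
  have hsum : (law K).real E = ∑ c ∈ Xᶜ, (law K).real (E ∩ {ω | f ω = c}) := by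
    conv_lhs => rw [hU]
    refine measureReal_biUnion_finset (fun c _ d _ hcd => ?_) fun c _ =>
      hE.inter (hf (measurableSet_singleton c))
    exact Set.disjoint_left.2 fun ω h1 h2 => hcd (h1.2.symm.trans h2.2)
  rw [hsum, Finset.sum_congr rfl heq, Finset.sum_const, nsmul_eq_mul]

/-- On this event `m` and the best arm are each uniform on the complement of `X`, so a fixed arm `b`
is one of them with probability at most `2 / |Xᶜ|`. -/
lemma card_sub_two_mul_measureReal_le (hK : 3 ≤ K) {X : Finset (Fin K)} (h0 : 0 ∈ X)
    {D : Set (Outcome K)} (hD : MeasurableSet D)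
    (hinv : ∀ b ∉ X, ∀ c ∉ X, ∀ ω ∈ D, ω.1.1 ∉ X → swapOutcome b c ω ∈ D)
    {b : Fin K} (hb : b ∉ X) :
    ((Xᶜ.card : ℝ) - 2) * (law K).real (D ∩ {ω | ω.1.1 ∉ X ∧ bestArm ω.1 ∉ X}) ≤
      Xᶜ.card * (law K).real (D ∩ {ω | ω.1.1 ∉ X ∧ bestArm ω.1 ∉ X} ∩
        {ω | b ≠ ω.1.1 ∧ b ≠ bestArm ω.1}) := by
  have hm : Measurable fun ω : Outcome K => ω.1.1 := measurable_fst.comp measurable_fst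
  have hA : Measurable fun ω : Outcome K => bestArm ω.1 :=
    (measurable_bestArm hK).comp measurable_fst
  have hne : ∀ c ∉ X, c ≠ 0 := fun c hc h => hc (h ▸ h0)
  have hAs : ∀ b ∉ X, ∀ c ∉ X, ∀ᵐ ω ∂(law K),
      bestArm (swapOutcome b c ω).1 = Equiv.swap b c (bestArm ω.1) := by
    intro b hb c hc
    filter_upwards [ae_injective_law] with ω hω
    exact bestArm_swapArms hK (hne b hb) (hne c hc) hω
  set E := D ∩ {ω : Outcome K | ω.1.1 ∉ X ∧ bestArm ω.1 ∉ X} with hEdef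
  have hE : MeasurableSet E :=
    hD.inter ((hm X.measurableSet).compl.inter (hA X.measurableSet).compl)
  have hEinv : ∀ b ∉ X, ∀ c ∉ X, ∀ᵐ ω ∂(law K), swapOutcome b c ω ∈ E ↔ ω ∈ E := by
    intro b hb c hc
    filter_upwards [hAs b hb c hc] with ω hω
    have h1 : (swapOutcome b c ω).1.1 ∉ X ↔ ω.1.1 ∉ X := by
      rw [swapOutcome_fst, swapArms_fst, swap_mem_iff hb hc]
    have h2 : bestArm (swapOutcome b c ω).1 ∉ X ↔ bestArm ω.1 ∉ X := by
      rw [hω, swap_mem_iff hb hc]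
    constructor
    · rintro ⟨hd, hx, hy⟩
      refine ⟨?_, h1.1 hx, h2.1 hy⟩
      -- Invariance is assumed in one direction only; the converse follows because an exchange is an
      -- involution.
      have := hinv b hb c hc _ hd hx
      rwa [swapOutcome_swapOutcome] at this
    · rintro ⟨hd, hx, hy⟩
      exact ⟨hinv b hb c hc _ hd hx, h1.2 hx, h2.2 hy⟩
  have e1 := card_mul_measureReal_eq h0 hE hEinv hm (fun ω h => h.2.1)
    (fun b _ c _ => Filter.Eventually.of_forall fun ω => rfl) hb
  have e2 := card_mul_measureReal_eq h0 hE hEinv hA (fun ω h => h.2.2) hAs hb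
  have hcover : E ⊆ (E ∩ {ω | b ≠ ω.1.1 ∧ b ≠ bestArm ω.1} ∪ E ∩ {ω | ω.1.1 = b}) ∪
      E ∩ {ω | bestArm ω.1 = b} := by
    intro ω h
    by_cases h1 : ω.1.1 = b
    · exact Or.inl (Or.inr ⟨h, h1⟩)
    by_cases h2 : bestArm ω.1 = b
    · exact Or.inr ⟨h, h2⟩
    exact Or.inl (Or.inl ⟨h, Ne.symm h1, Ne.symm h2⟩)
  have h1 := (measureReal_mono (μ := law K) hcover).trans (measureReal_union_le _ _)
  have h2 := measureReal_union_le (μ := law K) (E ∩ {ω | b ≠ ω.1.1 ∧ b ≠ bestArm ω.1})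
    (E ∩ {ω | ω.1.1 = b})
  have h3 := mul_le_mul_of_nonneg_left (h1.trans (add_le_add_left h2 _))
    (Nat.cast_nonneg (α := ℝ) Xᶜ.card)
  linarith

/-- If the first `n` queries are uninformative and do not include the first magic arm, then the
next query is uninformative with the probability of missing two arms out of `K - 1 - n`. -/
lemma uninformed_succ_ge (φ : Fin K → ℝ) (π : Policy K) (n : ℕ) (hK : n + 3 ≤ K) :
    ((K : ℝ) - 1 - n - 2) *
        (law K).real (Uninformed φ π n ∩ {ω | ∀ k < n, action φ π k ω ≠ 0}) ≤
      ((K : ℝ) - 1 - n) * (law K).real (Uninformed φ π (n + 1)) := by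
  classical
  have hK3 : 3 ≤ K := by omega
  -- The outcomes are split by the queried arms: `p.1` lists the first `n` queries, `p.2` is the
  -- next one, and `X p.1` collects the arms already excluded as `m` or best arm.
  let X : (Fin n → Fin K) → Finset (Fin K) := fun v => insert 0 (Finset.univ.image v)
  let D : (Fin n → Fin K) × Fin K → Set (Outcome K) := fun p =>
    {ω | (∀ k : Fin n, action φ π k ω = p.1 k ∧ p.1 k ≠ 0) ∧ action φ π n ω = p.2}
  let E : (Fin n → Fin K) × Fin K → Set (Outcome K) := fun p =>
    D p ∩ {ω | ω.1.1 ∉ X p.1 ∧ bestArm ω.1 ∉ X p.1}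
  let E' : (Fin n → Fin K) × Fin K → Set (Outcome K) := fun p =>
    E p ∩ {ω | p.2 ≠ ω.1.1 ∧ p.2 ≠ bestArm ω.1}
  have hm : Measurable fun ω : Outcome K => ω.1.1 := measurable_fst.comp measurable_fst
  have hA : Measurable fun ω : Outcome K => bestArm ω.1 :=
    (measurable_bestArm hK3).comp measurable_fst
  have hDm : ∀ p, MeasurableSet (D p) := by
    intro p
    refine MeasurableSet.inter (measurableSet_setOfPred.2 (Measurable.forall fun k =>
      measurableSet_setOfPred.1 (MeasurableSet.inter ?_ (.const _)))) ?_
    · exact measurableSet_eq_fun (measurable_action hK3 φ π k) measurable_const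
    · exact measurableSet_eq_fun (measurable_action hK3 φ π n) measurable_const
  have hE'm : ∀ p, MeasurableSet (E' p) := by
    intro p
    refine ((hDm p).inter ((hm (X p.1).measurableSet).compl.inter
      (hA (X p.1).measurableSet).compl)).inter (MeasurableSet.inter ?_ ?_)
    · exact (measurableSet_eq_fun measurable_const hm).compl
    · exact (measurableSet_eq_fun measurable_const hA).compl
  have hr : (2 : ℝ) ≤ (K : ℝ) - 1 - n := by
    have : ((n + 3 : ℕ) : ℝ) ≤ K := by exact_mod_cast hK
    push_cast at this
    linarith
  have hstep : ∀ p, ((K : ℝ) - 1 - n - 2) * (law K).real (E p) ≤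
      ((K : ℝ) - 1 - n) * (law K).real (E' p) := by
    intro p
    -- A next query inside `X` is uninformative for free.
    by_cases hp : p.2 ∈ X p.1
    · have hEE : E' p = E p := by
        refine Set.inter_eq_left.2 fun ω hω => ⟨fun h => hω.2.1 (h ▸ hp), fun h => hω.2.2 (h ▸ hp)⟩
      rw [hEE]
      have := measureReal_nonneg (μ := law K) (s := E p)
      nlinarith
    · have h := card_sub_two_mul_measureReal_le hK3 (X := X p.1) (by simp [X]) (hDm p) ?_ hp
      -- Repeated queries can make the complement larger than `K - 1 - n`. This only helps, since
      -- `(t - 2)/t` increases with `t`.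
      · have hcard : (K : ℝ) - 1 - n ≤ ((X p.1)ᶜ.card : ℝ) := by
          have h1 : (X p.1).card ≤ n + 1 :=
            (Finset.card_insert_le _ _).trans (Nat.succ_le_succ
              (Finset.card_image_le.trans_eq (by simp)))
          have h2 := Finset.card_add_card_compl (X p.1)
          rw [Fintype.card_fin] at h2
          have h3 : K ≤ (X p.1)ᶜ.card + (n + 1) := by omega
          have h4 : (K : ℝ) ≤ (X p.1)ᶜ.card + (n + 1) := by exact_mod_cast h3
          linarith
        change (((X p.1)ᶜ.card : ℝ) - 2) * (law K).real (E p) ≤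
          (X p.1)ᶜ.card * (law K).real (E' p) at h
        have hP := measureReal_nonneg (μ := law K) (s := E p)
        set t : ℝ := ((X p.1)ᶜ.card : ℝ)
        set r : ℝ := (K : ℝ) - 1 - n
        have ht : 0 < t := by linarith
        refine le_of_mul_le_mul_left ?_ ht
        have h5 := mul_le_mul_of_nonneg_left h (show 0 ≤ r by linarith)
        have h6 := mul_nonneg (sub_nonneg.2 hcard) hP
        linarith
      · rintro b hb c hc ω ⟨hk, hn⟩ hmX
        -- Only the first `n` queries need to be blind to the exchange: the choice of the next one
        -- depends on their rewards, not on its own. Arm `0` must be absent here because these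
        -- exchanges may move `m`.
        have hact : ∀ k < n, action φ π k ω ≠ b ∧ action φ π k ω ≠ c ∧ action φ π k ω ≠ ω.1.1 ∧
            (action φ π k ω = 0 → ω.1.1 ≠ b ∧ ω.1.1 ≠ c) := by
          intro k hkn
          obtain ⟨h1, h2⟩ := hk ⟨k, hkn⟩
          simp only at h1
          have hmem : action φ π k ω ∈ X p.1 := by
            rw [h1]
            exact Finset.mem_insert_of_mem (Finset.mem_image_of_mem _ (Finset.mem_univ _))
          exact ⟨fun h => hb (h ▸ hmem), fun h => hc (h ▸ hmem), fun h => hmX (h ▸ hmem),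
            fun h => absurd (h1.symm.trans h) h2⟩
        refine ⟨fun k => ⟨?_, (hk k).2⟩, ?_⟩
        · rw [action_swapOutcome φ π k fun l hl => hact l (hl.trans k.2)]
          exact (hk k).1
        · rw [action_swapOutcome φ π n hact]
          exact hn
  have hupper : (law K).real (Uninformed φ π n ∩ {ω | ∀ k < n, action φ π k ω ≠ 0}) ≤
      ∑ p, (law K).real (E p) := by
    have hsub : Uninformed φ π n ∩ {ω | ∀ k < n, action φ π k ω ≠ 0} ⊆
        (⋃ p, E p) ∪ {ω | ¬ ω.1.1 ≠ 0} := by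
      rintro ω ⟨hu, hz⟩
      by_cases hm0 : ω.1.1 = 0
      · exact Or.inr (by simpa using hm0)
      refine Or.inl (Set.mem_iUnion.2 ⟨(fun k => action φ π k ω, action φ π n ω),
        ⟨fun k => ⟨rfl, hz k k.2⟩, rfl⟩, ?_, ?_⟩)
      · simp only [X, Finset.mem_insert, Finset.mem_image, Finset.mem_univ, true_and, not_or,
          not_exists]
        exact ⟨hm0, fun k => (hu k k.2).1⟩
      · simp only [X, Finset.mem_insert, Finset.mem_image, Finset.mem_univ, true_and, not_or,
          not_exists]
        exact ⟨bestArm_ne_zero hK3 _, fun k => (hu k k.2).2⟩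
    have h0 : (law K).real {ω | ¬ ω.1.1 ≠ 0} = 0 := by
      rw [measureReal_def, ae_iff.1 (ae_magic_ne_zero_law hK3), ENNReal.toReal_zero]
    have h1 := (measureReal_mono (μ := law K) hsub).trans (measureReal_union_le _ _)
    rw [h0, add_zero] at h1
    exact h1.trans (measureReal_iUnion_fintype_le _)
  have hlower : ∑ p, (law K).real (E' p) ≤ (law K).real (Uninformed φ π (n + 1)) := by
    rw [← measureReal_biUnion_finset (s := Finset.univ) (f := E') ?_ fun p _ => hE'm p]
    · refine measureReal_mono ?_
      intro ω hω
      simp only [Finset.mem_univ, Set.iUnion_true, Set.mem_iUnion] at hω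
      obtain ⟨p, ⟨⟨hk, hn⟩, hmX, hAX⟩, hpm, hpA⟩ := hω
      intro k hk'
      rcases Nat.lt_succ_iff_lt_or_eq.1 hk' with hlt | rfl
      · have h1 : action φ π k ω = p.1 ⟨k, hlt⟩ := (hk ⟨k, hlt⟩).1
        have hmem : action φ π k ω ∈ X p.1 := by
          rw [h1]
          exact Finset.mem_insert_of_mem (Finset.mem_image_of_mem _ (Finset.mem_univ _))
        exact ⟨fun h => hmX (h ▸ hmem), fun h => hAX (h ▸ hmem)⟩
      · rw [hn]
        exact ⟨hpm, hpA⟩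
    · intro p _ q _ hpq
      refine Set.disjoint_left.2 fun ω h1 h2 => hpq (Prod.ext (funext fun k => ?_) ?_)
      · exact (h1.1.1.1 k).1.symm.trans (h2.1.1.1 k).1
      · exact h1.1.1.2.symm.trans h2.1.1.2
  calc ((K : ℝ) - 1 - n - 2) *
        (law K).real (Uninformed φ π n ∩ {ω | ∀ k < n, action φ π k ω ≠ 0})
      ≤ ((K : ℝ) - 1 - n - 2) * ∑ p, (law K).real (E p) :=
        mul_le_mul_of_nonneg_left hupper (by linarith)
    _ ≤ ((K : ℝ) - 1 - n) * ∑ p, (law K).real (E' p) := by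
        rw [Finset.mul_sum, Finset.mul_sum]
        exact Finset.sum_le_sum fun p _ => hstep p
    _ ≤ _ := mul_le_mul_of_nonneg_left hlower (by linarith)

/-! ### Expected number of queries -/

lemma uninformed_anti (φ : Fin K → ℝ) (π : Policy K) {m n : ℕ} (h : m ≤ n) :
    Uninformed φ π n ⊆ Uninformed φ π m := fun _ hω k hk => hω k (hk.trans_le h)

/-- The event that the strategy makes at least `n` queries. -/
def Continues (φ : Fin K → ℝ) (s : Strategy K) (n : ℕ) : Set (Outcome K) :=
  {ω | ∀ k < n, stoppingTime φ s ω ≠ k}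

lemma measurableSet_continues (hK : 3 ≤ K) (φ : Fin K → ℝ) (s : Strategy K) (n : ℕ) :
    MeasurableSet (Continues φ s n) := by
  refine measurableSet_setOfPred.2 (Measurable.forall fun k => measurableSet_setOfPred.1 ?_)
  exact MeasurableSet.imp (.const _) (measurableSet_stoppingTime_eq hK φ s k).compl

/-- An outcome uninformed after `n` queries either continues past `n` or has stopped at some `j ≤
n`, where it was also uninformed. Each of these `n + 1` stopping events has mass at most `2 K² δ`.
-/
lemma IsDeltaCorrect.le_continues {φ : Fin K → ℝ} {δ : ℝ} {s : Strategy K}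
    (hs : IsDeltaCorrect φ δ s) (n : ℕ) (hK : n + 4 ≤ K) :
    (law K).real (Uninformed φ s.toPolicy n) - (n + 1) * (2 * (K : ℝ) ^ 2 * δ) ≤
      (law K).real (Continues φ s (n + 1)) := by
  have hsub : Uninformed φ s.toPolicy n ⊆ Continues φ s (n + 1) ∪
      ⋃ j ∈ Finset.range (n + 1), Uninformed φ s.toPolicy j ∩ {ω | stoppingTime φ s ω = j} := by
    intro ω hω
    by_cases h : ω ∈ Continues φ s (n + 1)
    · exact Or.inl h
    · right
      simp only [Continues, Set.mem_ofPred_eq, not_forall, not_not] at h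
      obtain ⟨k, hk, hk'⟩ := h
      refine Set.mem_iUnion₂.2 ⟨k, Finset.mem_range.2 hk, ?_, hk'⟩
      exact uninformed_anti φ s.toPolicy (by omega) hω
  have h1 := (measureReal_mono (μ := law K) hsub).trans (measureReal_union_le _ _)
  have h2 := measureReal_biUnion_finset_le (μ := law K) (Finset.range (n + 1))
    fun j => Uninformed φ s.toPolicy j ∩ {ω | stoppingTime φ s ω = j}
  have h3 := Finset.sum_le_sum fun j (hj : j ∈ Finset.range (n + 1)) =>
    hs.uninformed_stop_le j (by have := Finset.mem_range.1 hj; omega)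
  rw [Finset.sum_const, Finset.card_range, nsmul_eq_mul] at h3
  push_cast at h3
  linarith

/-- This is the tail-sum formula `E[τ] = ∑ P(τ ≥ n + 1)`, truncated at `N`. -/
lemma sum_continues_le_expectedStoppingTime (hK : 3 ≤ K) (φ : Fin K → ℝ) (s : Strategy K) (N : ℕ) :
    ∑ n ∈ Finset.range N, law K (Continues φ s (n + 1)) ≤ expectedStoppingTime φ s := by
  unfold expectedStoppingTime
  rw [Finset.sum_congr rfl fun n _ =>
    (lintegral_indicator_one (measurableSet_continues hK φ s (n + 1))).symm,
    ← lintegral_finsetSum _ fun n _ =>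
      measurable_one.indicator (measurableSet_continues hK φ s (n + 1))]
  refine lintegral_mono fun ω => ?_
  induction h : stoppingTime φ s ω using ENat.recTopCoe with
  | top => simp
  | coe m =>
    have hle : ∀ n ∈ Finset.range N, (Continues φ s (n + 1)).indicator (1 : Outcome K → ENNReal) ω ≤
        if n ∈ Finset.range m then 1 else 0 := by
      intro n _
      by_cases hn : n < m
      · rw [if_pos (Finset.mem_range.2 hn)]
        exact Set.indicator_le_self' (fun _ _ => zero_le) ω
      · rw [Set.indicator_of_notMem]
        · exact zero_le
        · exact fun hc => hc m (by omega) h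
    refine (Finset.sum_le_sum hle).trans ?_
    rw [← Finset.sum_filter]
    simp only [Finset.sum_const, nsmul_eq_mul, mul_one, ENat.toENNReal_coe, Nat.cast_le]
    refine (Finset.card_le_card (t := Finset.range m) fun n hn => ?_).trans_eq
      (Finset.card_range m)
    exact (Finset.mem_filter.1 hn).2

lemma two_lt_expectedStoppingTime (hK : 7 ≤ K) {φ : Fin K → ℝ} (hφ : Function.Injective φ)
    {δ : ℝ} (hδ : δ ≤ 1 / (200 * (K : ℝ) ^ 2)) {s : Strategy K}
    (hids : IsMyopicIDS φ s.toPolicy) (hs : IsDeltaCorrect φ δ s) :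
    2 < expectedStoppingTime φ s := by
  have := isProbabilityMeasure_law (K := K) (by omega)
  have hKr : (7 : ℝ) ≤ K := by exact_mod_cast hK
  have hε : 2 * (K : ℝ) ^ 2 * δ ≤ 1 / 100 := by
    have h := mul_le_mul_of_nonneg_left hδ (show 0 ≤ 2 * (K : ℝ) ^ 2 by positivity)
    refine h.trans_eq ?_
    field_simp
    norm_num
  have hP0 : (law K).real (Uninformed φ s.toPolicy 0) = 1 := by
    rw [show Uninformed φ s.toPolicy 0 = Set.univ from
      Set.eq_univ_of_forall fun ω k hk => absurd hk (Nat.not_lt_zero k), probReal_univ]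
  have h1 := uninformed_succ_ge φ s.toPolicy 0 (by omega)
  have h2 := uninformed_succ_ge φ s.toPolicy 1 (by omega)
  have e1 : (law K).real (Uninformed φ s.toPolicy 0 ∩
      {ω | ∀ k < 0, action φ s.toPolicy k ω ≠ 0}) = 1 := by
    rw [Set.inter_eq_left.2 fun ω _ k hk => absurd hk (Nat.not_lt_zero k), hP0]
  have e2 : (law K).real (Uninformed φ s.toPolicy 1 ∩
      {ω | ∀ k < 1, action φ s.toPolicy k ω ≠ 0}) = (law K).real (Uninformed φ s.toPolicy 1) := by
    -- The only use of the myopic rule: the first query is almost surely not arm `0`, so the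
    -- symmetry argument applies to the second query, which may itself be arm `0`.
    refine measureReal_congr ?_
    filter_upwards [hids.ae_action_zero_ne_zero hK hφ] with ω hω
    refine propext (and_iff_left fun k hk => ?_)
    obtain rfl : k = 0 := by omega
    exact hω
  rw [e1] at h1
  rw [e2] at h2
  push_cast at h1 h2
  -- For `K ≥ 7` the factors are `(K-3)/(K-1) ≥ 2/3` and `(K-4)/(K-2) ≥ 3/5`, with product at least
  -- `2/5`.
  have hP1 : 2 / 3 ≤ (law K).real (Uninformed φ s.toPolicy 1) := by
    refine le_of_mul_le_mul_left (le_trans ?_ h1) (by linarith)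
    linarith
  have hP2 : 2 / 5 ≤ (law K).real (Uninformed φ s.toPolicy 2) := by
    refine le_of_mul_le_mul_left (le_trans ?_ h2) (show (0 : ℝ) < (K : ℝ) - 1 - 1 by linarith)
    have := mul_le_mul_of_nonneg_left hP1 (show (0 : ℝ) ≤ (K : ℝ) - 1 - 1 - 2 by linarith)
    linarith
  have c0 := hs.le_continues 0 (by omega)
  have c1 := hs.le_continues 1 (by omega)
  have c2 := hs.le_continues 2 (by omega)
  rw [hP0] at c0
  push_cast at c0 c1 c2
  refine lt_of_lt_of_le ?_ (sum_continues_le_expectedStoppingTime (by omega) φ s 3)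
  -- The total loss is at most `(1 + 2 + 3)/100`, and `1 + 2/3 + 2/5 - 6/100 > 2`.
  have hreal : (2 : ℝ) < ∑ n ∈ Finset.range 3, (law K).real (Continues φ s (n + 1)) := by
    simp only [Finset.sum_range_succ, Finset.sum_range_zero]
    linarith
  rw [Finset.sum_congr rfl fun n _ => (ofReal_measureReal (μ := law K)).symm,
    ← ENNReal.ofReal_sum_of_nonneg fun n _ => measureReal_nonneg, ← ENNReal.ofReal_ofNat]
  exact (ENNReal.ofReal_lt_ofReal_iff (by linarith)).2 hreal

/-! ### Following the chain of magic arms -/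

lemma measurable_invFun (φ : Fin K → ℝ) : Measurable (Function.invFun φ) := by
  classical
  refine Measurable.measurable_of_countable_ne
    (f := fun _ => Classical.arbitrary (Fin K)) measurable_const ?_
  refine (Set.finite_range φ).countable.mono fun y hy => ?_
  by_contra h
  exact hy (Function.invFun_neg fun ⟨x, hx⟩ => h ⟨x, hx⟩).symm

/-- Query the first magic arm, decode the second magic arm `m`, query `m`, decode the best arm. -/
noncomputable def chainStrategy (φ : Fin K → ℝ) : Strategy K where
  act
    | 0 => fun _ _ => 0
    -- The entry `h 0` holds the first reward `φ m`. The same rule serves all later rounds, but the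
    -- strategy stops after two pulls.
    | _ + 1 => fun h _ => Function.invFun φ (h 0).2
  measurable_act := by
    rintro (_ | n)
    · exact measurable_const
    · exact (measurable_invFun φ).comp
        (measurable_snd.comp ((measurable_pi_apply 0).comp measurable_fst))
  stopSet n := {_h | n = 2}
  measurableSet_stopSet _ := .const _
  guess
    | 0 => fun _ => 0
    | n + 1 => fun h => Function.invFun φ (h (Fin.last n)).2
  measurable_guess := by
    rintro (_ | n)
    · exact measurable_const
    · exact (measurable_invFun φ).comp (measurable_snd.comp (measurable_pi_apply (Fin.last n)))

lemma stoppingTime_chainStrategy (φ : Fin K → ℝ) (ω : Outcome K) :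
    stoppingTime φ (chainStrategy φ) ω = 2 := by
  have h := (stoppingTime_eq_coe_iff φ (chainStrategy φ) ω 2).2
    ⟨rfl, fun k hk h => absurd (show k = 2 from h) (by omega)⟩
  exact_mod_cast h

lemma guess_chainStrategy {φ : Fin K → ℝ} (hφ : Function.Injective φ) {ω : Outcome K}
    (hω : ω.1.1 ≠ 0) :
    (chainStrategy φ).guess 2 (history φ (chainStrategy φ).toPolicy 2 ω) = bestArm ω.1 := by
  have hinv : ∀ a, Function.invFun φ (φ a) = a := Function.leftInverse_invFun hφ
  have h1 : history φ (chainStrategy φ).toPolicy 1 ω 0 = (0, φ ω.1.1) := by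
    have hr : reward φ ω.1 0 (ω.2.1 0) = φ ω.1.1 := if_pos rfl
    rw [← hr]
    exact Fin.snoc_last (α := fun _ => Fin K × ℝ) (n := 0) _ _
  have ha : action φ (chainStrategy φ).toPolicy 1 ω = ω.1.1 := by
    change Function.invFun φ (history φ (chainStrategy φ).toPolicy 1 ω 0).2 = ω.1.1
    rw [h1, hinv]
  have h2 : (history φ (chainStrategy φ).toPolicy 2 ω (Fin.last 1)).2 = φ (bestArm ω.1) := by
    have hr : reward φ ω.1 (action φ (chainStrategy φ).toPolicy 1 ω) (ω.2.1 1) =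
        φ (bestArm ω.1) := by
      rw [ha, reward, if_neg hω, if_pos rfl]
    rw [← hr]
    exact congrArg Prod.snd (Fin.snoc_last (α := fun _ => Fin K × ℝ) (n := 1) _ _)
  change Function.invFun φ (history φ (chainStrategy φ).toPolicy 2 ω (Fin.last 1)).2 = _
  rw [h2, hinv]

lemma isDeltaCorrect_chainStrategy (hK : 3 ≤ K) {φ : Fin K → ℝ} (hφ : Function.Injective φ)
    {δ : ℝ} (hδ : 0 ≤ δ) : IsDeltaCorrect φ δ (chainStrategy φ) := by
  have := isProbabilityMeasure_law hK
  have h : (law K).real {ω | ∃ n : ℕ, stoppingTime φ (chainStrategy φ) ω = n ∧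
      (chainStrategy φ).guess n (history φ (chainStrategy φ).toPolicy n ω) = bestArm ω.1} = 1 := by
    rw [← probReal_univ (μ := law K)]
    refine measureReal_congr ?_
    filter_upwards [ae_magic_ne_zero_law hK] with ω hω
    refine propext (iff_of_true ⟨2, ?_, guess_chainStrategy hφ hω⟩ trivial)
    exact_mod_cast stoppingTime_chainStrategy φ ω
  unfold IsDeltaCorrect
  linarith

end MagicChain

theorem mainTheorem11 (K : ℕ) [NeZero K] (hK : 7 ≤ K) :
    ∃ δ₀ : ℝ, 0 < δ₀ ∧ δ₀ < 1 / 2 ∧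
      ∀ φ : Fin K → ℝ, Function.Injective φ → ∀ δ : ℝ, 0 < δ → δ ≤ δ₀ →
        (∀ s : MagicChain.Strategy K, MagicChain.IsMyopicIDS φ s.toPolicy →
          ¬ MagicChain.IsSampleOptimal φ δ s) ∧
        (∀ s : MagicChain.Strategy K, MagicChain.IsMyopicIDS φ s.toPolicy →
          MagicChain.IsDeltaCorrect φ δ s → 2 < MagicChain.expectedStoppingTime φ s) ∧
        (∃ s : MagicChain.Strategy K, MagicChain.IsDeltaCorrect φ δ s ∧
          ∀ ω, MagicChain.stoppingTime φ s ω = 2) := by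
  have hKr : (7 : ℝ) ≤ K := by exact_mod_cast hK
  -- This threshold makes the stopping loss `2 K² δ` at most `1/100`.
  refine ⟨1 / (200 * (K : ℝ) ^ 2), by positivity, ?_, fun φ hφ δ hδ hδ₀ => ⟨?_, ?_, ?_⟩⟩
  · refine one_div_lt_one_div_of_lt (by norm_num) ?_
    nlinarith
  · rintro s hids ⟨hs, hopt⟩
    have h := hopt _ (MagicChain.isDeltaCorrect_chainStrategy (by omega) hφ hδ.le)
    have := MagicChain.isProbabilityMeasure_law (K := K) (by omega)
    have h2 : MagicChain.expectedStoppingTime φ (MagicChain.chainStrategy φ) = 2 := by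
      simp [MagicChain.expectedStoppingTime, MagicChain.stoppingTime_chainStrategy]
    rw [h2] at h
    exact absurd (MagicChain.two_lt_expectedStoppingTime hK hφ hδ₀ hids hs) (not_lt.2 h)
  · exact fun s hids hs => MagicChain.two_lt_expectedStoppingTime hK hφ hδ₀ hids hs
  · exact ⟨MagicChain.chainStrategy φ, MagicChain.isDeltaCorrect_chainStrategy (by omega) hφ hδ.le,
      MagicChain.stoppingTime_chainStrategy φ⟩
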